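/- Let $Y_1,Y_2,\dots$ be independent real random variables on a probability space. For constants $\nu_0,\nu_1,\nu_2$ put $V(\theta)=\nu_0+\nu_1\theta+\nu_2\theta^2$. For positive numbers $\tau_i$ and real numbers $\theta_i$, consider the conditions (A) $\limsup_{p\to\infty}\frac1p\sum_{i=1}^p\operatorname{Var}(Y_i)<\infty$; (B) $\limsup_{p\to\infty}\frac1p\sum_{i=1}^p\operatorname{Var}(Y_i)\,\theta_i^2<\infty$; (C) $\limsup_{p\to\infty}\frac1p\sum_{i=1}^p\operatorname{Var}(Y_i^2)<\infty$; (D) $\tau_i+\nu_2\neq 0$ for all $i$, $\sup_i\bigl(\frac{\tau_i}{\tau_i+\nu_2}\bigr)^2<\infty$ and $\sup_i\bigl(\frac{\nu_1}{\tau_i+\nu_2}\bigr)^2<\infty$; (E) $\limsup_{p\to\infty}\frac1{p^{1-\varepsilon}}E\bigl(\max_{1\le i\le p}Y_i^2\bigr)<\infty$ for some $\varepsilon>0$. In each of the following five cases $E(Y_i)=\theta_i$, $V(\theta_i)\ge 0$ and $\operatorname{Var}(Y_i)=V(\theta_i)/\tau_i$ for all $i$, and conditions (A)–(E) hold. 1.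 Binomial: $Y_i\sim\mathrm{Bin}(n_i,p_i)/n_i$ with $p_i\in[0,1]$, $(\nu_0,\nu_1,\nu_2)=(0,1,-1)$, $\tau_i=n_i$, $\theta_i=p_i$; and $n_i\ge 2$ for all $i$. 2. Poisson: $Y_i\sim\mathrm{Poi}(\tau_i\theta_i)/\tau_i$, $(\nu_0,\nu_1,\nu_2)=(0,1,0)$; and $\inf_i\tau_i>0$, $\inf_i\tau_i\theta_i>0$, $\sum_{i=1}^p\theta_i^3=O(p)$ as $p\to\infty$. 3. Negative binomial: $Y_i\sim\mathrm{NBin}(n_i,p_i)/n_i$ with real $n_i>0$ and $p_i\in(0,1)$, where $\mathrm{NBin}(n,p)$ gives mass $\binom{n+k-1}{k}p^k(1-p)^n$ to $k=0,1,2,\dots$; $(\nu_0,\nu_1,\nu_2)=(0,1,1)$, $\tau_i=n_i$, $\theta_i=\frac{p_i}{1-p_i}$; and $\inf_i n_ip_i>0$, $\sum_{i=1}^p\bigl(\frac{p_i}{1-p_i}\bigr)^4=O(p)$. 4. Gamma: $Y_i\sim\Gamma(\tau_i\alpha,\lambda_i)/\tau_i$ with shape $\tau_i\alpha$ and scale $\lambda_i>0$,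 where $\alpha>0$ is fixed; $(\nu_0,\nu_1,\nu_2)=(0,0,1/\alpha)$, $\theta_i=\alpha\lambda_i$; and $\inf_i\tau_i>0$, $\sum_{i=1}^p\lambda_i^4=O(p)$. 5. Generalized hyperbolic secant: $Y_i\sim\mathrm{GHS}(\tau_i\alpha,\lambda_i)/\tau_i$ with $\lambda_i\in\mathbb R$, where $\alpha>0$ is fixed and $\mathrm{GHS}(r,\lambda)$ has density $$\frac{2^{r-2}}{\pi\,\Gamma(r)}\Bigl|\Gamma\Bigl(\frac{r+ix}{2}\Bigr)\Bigr|^2(1+\lambda^2)^{-r/2}e^{x\arctan\lambda},\qquad x\in\mathbb R;$$ $(\nu_0,\nu_1,\nu_2)=(\alpha,0,1/\alpha)$, $\theta_i=\alpha\lambda_i$; and $\inf_i\tau_i>0$, $\sum_{i=1}^p\lambda_i^4=O(p)$. -/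

import Mathlib

open MeasureTheory ProbabilityTheory Filter Asymptotics
open scoped ENNReal

noncomputable section

/-- The negative binomial distribution on `ℕ` with convolution parameter `r > 0` (not necessarily
an integer) and parameter `p ∈ (0, 1)`: the point `k` has mass
`(r + k - 1 choose k) * p ^ k * (1 - p) ^ r`, so that the mean is `r * p / (1 - p)`. -/
def negBinomialMeasure (r p : ℝ) : Measure ℕ :=
  Measure.sum fun k : ℕ =>
    ENNReal.ofReal (Ring.choose (r + (k : ℝ) - 1) k * p ^ k * (1 - p) ^ r) • Measure.dirac k

/-- The density of the generalized hyperbolic secant distribution `GHS(r, l)` with convolution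
parameter `r > 0` and parameter `l ∈ ℝ`,
`2 ^ (r - 2) / (π * Γ(r)) * |Γ((r + i * x) / 2)| ^ 2 * (1 + l ^ 2) ^ (-r / 2) * exp (x * arctan l)`.
For `r = 1` and `l = 0` this is the hyperbolic secant density `1 / (2 * cosh (π * x / 2))`.
The mean is `r * l` and the variance is `r * (1 + l ^ 2)`. -/
def ghsPDFReal (r l x : ℝ) : ℝ :=
  (2 : ℝ) ^ (r - 2) / (Real.pi * Real.Gamma r)
    * ‖Complex.Gamma (((r : ℂ) + Complex.I * (x : ℂ)) / 2)‖ ^ 2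
    * (1 + l ^ 2) ^ (-r / 2) * Real.exp (x * Real.arctan l)

/-- The generalized hyperbolic secant distribution `GHS(r, l)` on the real line. -/
def ghsMeasure (r l : ℝ) : Measure ℝ :=
  volume.withDensity fun x => ENNReal.ofReal (ghsPDFReal r l x)

/-- The observations `Y 0, Y 1, …` have means `θ i` and variances `V (θ i) / τ i`, where
`V t = ν₀ + ν₁ * t + ν₂ * t ^ 2`. The variance is taken with values in `[0, ∞]`, so the equation for
it includes its finiteness. -/
structure HasQuadraticVariance {Ω : Type*} [MeasurableSpace Ω] (ν₀ ν₁ ν₂ : ℝ) (τ θ : ℕ → ℝ)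
    (Y : ℕ → Ω → ℝ) (P : Measure Ω) : Prop where
  tau_pos : ∀ i, 0 < τ i
  integrable : ∀ i, Integrable (Y i) P
  mean : ∀ i, ∫ ω, Y i ω ∂P = θ i
  nonneg : ∀ i, 0 ≤ ν₀ + ν₁ * θ i + ν₂ * θ i ^ 2
  variance : ∀ i,
    evariance (Y i) P = ENNReal.ofReal ((ν₀ + ν₁ * θ i + ν₂ * θ i ^ 2) / τ i)

/-- The regularity conditions (A)–(E) on a sequence of observations `Y 0, Y 1, …`, in which the sums
and maxima run over the first `p` observations. Variances and expectations of nonnegative variables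
take values in `[0, ∞]`. Condition (D) includes that its quotients have nonzero denominators. -/
structure RegularityConditions {Ω : Type*} [MeasurableSpace Ω] (ν₁ ν₂ : ℝ) (τ θ : ℕ → ℝ)
    (Y : ℕ → Ω → ℝ) (P : Measure Ω) : Prop where
  condA : limsup (fun p : ℕ =>
    (∑ i ∈ Finset.range p, evariance (Y i) P) / (p : ℝ≥0∞)) atTop < ∞
  condB : limsup (fun p : ℕ =>
    (∑ i ∈ Finset.range p, evariance (Y i) P * ENNReal.ofReal (θ i ^ 2)) / (p : ℝ≥0∞)) atTop < ∞
  condC : limsup (fun p : ℕ =>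
    (∑ i ∈ Finset.range p, evariance (fun ω => Y i ω ^ 2) P) / (p : ℝ≥0∞)) atTop < ∞
  condD : (∀ i, τ i + ν₂ ≠ 0) ∧
    BddAbove (Set.range fun i => (τ i / (τ i + ν₂)) ^ 2) ∧
    BddAbove (Set.range fun i => (ν₁ / (τ i + ν₂)) ^ 2)
  condE : ∃ ε : ℝ, 0 < ε ∧ limsup (fun p : ℕ =>
    (∫⁻ ω, (Finset.range p).sup (fun i => ENNReal.ofReal (Y i ω ^ 2)) ∂P)
      / (p : ℝ≥0∞) ^ (1 - ε)) atTop < ∞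

end

/-!
Apart from elementary bounds on quotients of the constants, every condition in the statement is a
bound on averages of moments of order at most four, so the proof has two halves.

*From moments to conditions.* Let `q i` have bounded averages. If `Var (Y i)`,
`Var (Y i) * θ i ^ 2` and `Var (Y i ^ 2)` are at most `q i`, the three averages are bounded. Since
the maximum of the `Y i ^ 2` is at most the square root of `∑ i, Y i ^ 4`, Jensen's inequality
gives `E (max Y i ^ 2) ≤ (∑ i, E (Y i ^ 4)) ^ (1 / 2)`, and a bound `E (Y i ^ 4) ≤ q i ^ (4 / 3)`
makes this `O(p ^ (2 / 3))`, which is the last condition with `ε = 1 / 3`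
(`regularity_of_moments`). The exponent `4 / 3` is needed for the Poisson family, where only the
third powers of the means have bounded averages while the fourth moment contains `θ i ^ 4`. For the
other families `E (Y i ^ 4)` itself has bounded averages, and this controls everything else
(`regularity_of_fourth_moment_le`).

*Moments of the five families.* For each family, multiplying the weight or density by a factor
moves a parameter, which reduces moments to normalization. For the three discrete laws
`(k + 1) * w (k + 1) = c * w' k`, where `w'` belongs to the same family
(`HasSum.mul_descFactorial_succ`), which gives all factorial moments; for the gamma law
multiplication by `x` raises the shape by one; for the generalized hyperbolic secant law with
density `f_r`, `(r ^ 2 + x ^ 2) * f_r(x) = r * (r + 1) * (1 + l ^ 2) * f_{r + 2}(x)`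
(`ghsPDFReal_mul_sq_add_sq`).

The last family needs its moment generating function, that is, the integral of
`‖Γ((r + i * x) / 2)‖ ^ 2 * exp (x * ψ)` for `|ψ| < π / 2`. By Euler's integral along the ray with
direction `exp (i * ψ)` (`mellin_exp_neg_mul`) and the substitution `t = exp (-u)`, the function
`ξ ↦ exp (2 * π * ψ * ξ) * ‖Γ(r / 2 + 2 * π * i * ξ)‖` is the modulus of the Fourier transform of
`exp (-(r / 2) * u) * exp (-exp (i * ψ - u))`. Euler's integral for slightly different angles gives
exponential decay (`exists_exp_mul_norm_Gamma_le`), so Fourier inversion yields Plancherel's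
identity (`integral_norm_sq_fourier`), and the integral becomes the elementary
`∫ exp (-r * u) * exp (-2 * cos ψ * exp (-u))` (`integral_exp_mul_norm_Gamma_sq`). The mean is the
derivative of the moment generating function at `0`.
-/

/-! ### Euler's integral along a ray and the decay of the Gamma function -/

section GammaOnLines

open Complex Set
open scoped FourierTransform Topology

lemma integrableOn_rpow_mul_exp_neg_mul {s b : ℝ} (hs : -1 < s) (hb : 0 < b) :
    IntegrableOn (fun t : ℝ => t ^ s * Real.exp (-(b * t))) (Ioi 0) := by
  simpa using integrableOn_rpow_mul_exp_neg_mul_rpow hs one_pos hb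

lemma norm_cpow_mul_exp_neg_mul {a z : ℂ} {t : ℝ} (ht : 0 < t) :
    ‖(t : ℂ) ^ a * cexp (-(z * t))‖ = t ^ a.re * Real.exp (-(z.re * t)) := by
  rw [norm_mul, norm_cpow_eq_rpow_re_of_pos ht, norm_exp]
  simp

lemma aestronglyMeasurable_cpow_mul_exp_neg_mul (a z : ℂ) :
    AEStronglyMeasurable (fun t : ℝ => (t : ℂ) ^ a * cexp (-(z * t)))
      (volume.restrict (Ioi 0)) := by
  refine ContinuousOn.aestronglyMeasurable (fun t ht => ?_) measurableSet_Ioi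
  refine ContinuousAt.continuousWithinAt (ContinuousAt.mul ?_ (by fun_prop))
  exact continuousAt_ofReal_cpow_const _ _ (Or.inr (ne_of_gt ht))

lemma integrableOn_cpow_mul_exp_neg_mul {a z : ℂ} (ha : -1 < a.re) (hz : 0 < z.re) :
    IntegrableOn (fun t : ℝ => (t : ℂ) ^ a * cexp (-(z * t))) (Ioi 0) := by
  refine (integrableOn_rpow_mul_exp_neg_mul ha hz).mono'
    (aestronglyMeasurable_cpow_mul_exp_neg_mul a z) ?_
  filter_upwards [ae_restrict_mem measurableSet_Ioi] with t ht
  exact (norm_cpow_mul_exp_neg_mul ht).le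

lemma mellinConvergent_exp_neg_mul {a z : ℂ} (ha : 0 < a.re) (hz : 0 < z.re) :
    MellinConvergent (fun t : ℝ => cexp (-(z * t))) a :=
  integrableOn_cpow_mul_exp_neg_mul (by simpa using ha) hz

lemma differentiableAt_mellin_exp_neg_mul {a z : ℂ} (ha : 0 < a.re) (hz : 0 < z.re) :
    DifferentiableAt ℂ (fun w : ℂ => mellin (fun t : ℝ => cexp (-(w * t))) a) z := by
  have hz2 : 0 < z.re / 2 := by positivity
  refine (hasDerivAt_integral_of_dominated_loc_of_deriv_le (𝕜 := ℂ)
    (F := fun (w : ℂ) (t : ℝ) => (t : ℂ) ^ (a - 1) • cexp (-(w * t)))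
    (F' := fun (w : ℂ) (t : ℝ) => (t : ℂ) ^ (a - 1) * (cexp (-(w * t)) * (-t)))
    (bound := fun t : ℝ => t ^ a.re * Real.exp (-(z.re / 2 * t)))
    (Metric.ball_mem_nhds z hz2) ?_ ?_ ?_ ?_ ?_ ?_).2.differentiableAt
  · exact Eventually.of_forall fun w => aestronglyMeasurable_cpow_mul_exp_neg_mul _ _
  · exact mellinConvergent_exp_neg_mul ha hz
  · simp_rw [← mul_assoc]
    exact (aestronglyMeasurable_cpow_mul_exp_neg_mul _ _).mul
      (by fun_prop : Continuous fun t : ℝ => -(t : ℂ)).aestronglyMeasurable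
  · filter_upwards [ae_restrict_mem measurableSet_Ioi] with t (ht : 0 < t) w hw
    have hre : z.re / 2 ≤ w.re := by
      have h1 : |(w - z).re| < z.re / 2 :=
        (abs_re_le_norm _).trans_lt (by simpa [dist_eq] using hw)
      rw [sub_re] at h1
      linarith [(abs_lt.1 h1).1]
    rw [← mul_assoc, norm_mul, norm_cpow_mul_exp_neg_mul ht, norm_neg, norm_real,
      Real.norm_of_nonneg ht.le, mul_right_comm]
    have hpow : t ^ (a - 1).re * t = t ^ a.re := by
      rw [sub_re, one_re, Real.rpow_sub_one ht.ne', div_mul_cancel₀ _ ht.ne']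
    rw [hpow]
    gcongr
  · exact integrableOn_rpow_mul_exp_neg_mul (by linarith) hz2
  · refine Eventually.of_forall fun t w _ => ?_
    have h1 : HasDerivAt (fun w : ℂ => -(w * t)) (-(t : ℂ)) w := by
      simpa using ((hasDerivAt_id w).mul_const (t : ℂ)).fun_neg
    simpa using h1.cexp.const_mul ((t : ℂ) ^ (a - 1))

/-- Euler's integral for the Gamma function along a ray: the identity for real `z > 0` extends to
the right half-plane by the identity theorem. -/
theorem mellin_exp_neg_mul {a z : ℂ} (ha : 0 < a.re) (hz : 0 < z.re) :
    mellin (fun t : ℝ => cexp (-(z * t))) a = z ^ (-a) * Gamma a := by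
  have hopen : IsOpen {w : ℂ | 0 < w.re} := isOpen_lt continuous_const continuous_re
  have hf : AnalyticOnNhd ℂ (fun w : ℂ => mellin (fun t : ℝ => cexp (-(w * t))) a)
      {w : ℂ | 0 < w.re} :=
    DifferentiableOn.analyticOnNhd
      (fun w hw => (differentiableAt_mellin_exp_neg_mul ha hw).differentiableWithinAt) hopen
  have hg : AnalyticOnNhd ℂ (fun w : ℂ => w ^ (-a) * Gamma a) {w : ℂ | 0 < w.re} := by
    refine DifferentiableOn.analyticOnNhd (fun w hw => ?_) hopen
    exact ((differentiableAt_id.cpow_const (Or.inl hw)).mul_const _).differentiableWithinAt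
  -- it remains to see that the two sides agree at real points accumulating at `1`
  refine hf.eqOn_of_preconnected_of_frequently_eq hg (convex_halfSpace_re_gt 0).isPreconnected
    (z₀ := 1) (by simp) ?_ hz
  have ht : Tendsto (fun x : ℝ => (x : ℂ)) (𝓝[≠] 1) (𝓝[≠] 1) := by
    refine tendsto_nhdsWithin_iff.2 ⟨?_, ?_⟩
    · exact (continuous_ofReal.tendsto' 1 1 (by simp)).mono_left nhdsWithin_le_nhds
    · filter_upwards [self_mem_nhdsWithin] with x hx
      simpa using hx
  refine ht.frequently (Eventually.frequently ?_)
  filter_upwards [nhdsWithin_le_nhds (Ioi_mem_nhds (zero_lt_one' ℝ))] with x (hx : 0 < x)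
  have h := integral_cpow_mul_exp_neg_mul_Ioi ha hx
  rw [one_div, inv_cpow _ _ (by simp [arg_ofReal_of_nonneg hx.le, Real.pi_pos.ne]),
    ← cpow_neg] at h
  exact h

lemma norm_exp_mul_I_cpow_neg {ψ : ℝ} (hψ : |ψ| < Real.pi / 2) (a : ℂ) :
    ‖cexp (ψ * I) ^ (-a)‖ = Real.exp (ψ * a.im) := by
  obtain ⟨h1, h2⟩ := abs_lt.1 hψ
  rw [cpow_def_of_ne_zero (exp_ne_zero _), log_exp (by simp; linarith [Real.pi_pos])
    (by simp; linarith [Real.pi_pos]), norm_exp]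
  simp

lemma exp_mul_I_re_pos {ψ : ℝ} (hψ : |ψ| < Real.pi / 2) : 0 < (cexp (ψ * I)).re := by
  rw [exp_ofReal_mul_I_re]
  exact Real.cos_pos_of_mem_Ioo (abs_lt.1 hψ)

lemma norm_mellin_exp_neg_mul {a : ℂ} (ha : 0 < a.re) {ψ : ℝ} (hψ : |ψ| < Real.pi / 2) :
    ‖mellin (fun t : ℝ => cexp (-(cexp (ψ * I) * t))) a‖ = Real.exp (ψ * a.im) * ‖Gamma a‖ := by
  rw [mellin_exp_neg_mul ha (exp_mul_I_re_pos hψ), norm_mul, norm_exp_mul_I_cpow_neg hψ]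

/-- The triangle inequality in Euler's integral along the ray with direction `exp (ψ * I)`; the
bound does not depend on `y` because `y` only enters through the phase of `t ^ (σ - 1 + y * I)`. -/
lemma exp_mul_norm_Gamma_le {σ : ℝ} (hσ : 0 < σ) {ψ : ℝ} (hψ : |ψ| < Real.pi / 2) :
    ∃ C : ℝ, ∀ y : ℝ, Real.exp (ψ * y) * ‖Gamma (σ + y * I)‖ ≤ C := by
  refine ⟨∫ t in Ioi (0 : ℝ), t ^ (σ - 1) * Real.exp (-((cexp (ψ * I)).re * t)), fun y => ?_⟩
  have ha : 0 < ((σ : ℂ) + y * I).re := by simpa using hσ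
  have h := norm_mellin_exp_neg_mul ha hψ
  simp only [add_im, ofReal_im, mul_im, ofReal_re, I_im, mul_one, I_re, mul_zero, add_zero,
    zero_add] at h
  rw [← h, mellin]
  refine (norm_integral_le_integral_norm _).trans_eq ?_
  refine setIntegral_congr_fun measurableSet_Ioi fun t ht => ?_
  simp only [smul_eq_mul]
  rw [norm_cpow_mul_exp_neg_mul ht]
  simp

/-- On a vertical line the Gamma function decays like `exp (-c * |y|)` for every `c < π / 2`. -/
lemma exists_exp_mul_norm_Gamma_le {σ : ℝ} (hσ : 0 < σ) {ψ : ℝ} (hψ : |ψ| < Real.pi / 2) :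
    ∃ C δ : ℝ, 0 < δ ∧ ∀ y : ℝ,
      Real.exp (ψ * y) * ‖Gamma (σ + y * I)‖ ≤ C * Real.exp (-(δ * |y|)) := by
  -- the bounds for the angles `ψ + δ` and `ψ - δ` together give the factor `exp (-(δ * |y|))`
  obtain ⟨δ, hδ, hδ'⟩ : ∃ δ : ℝ, 0 < δ ∧ |ψ| + δ < Real.pi / 2 :=
    ⟨(Real.pi / 2 - |ψ|) / 2, by linarith, by linarith⟩
  have hp : |ψ + δ| < Real.pi / 2 := (abs_add_le _ _).trans_lt (by rwa [abs_of_pos hδ])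
  have hm : |ψ - δ| < Real.pi / 2 := (abs_sub _ _).trans_lt (by rwa [abs_of_pos hδ])
  obtain ⟨C₁, hC₁⟩ := exp_mul_norm_Gamma_le hσ hp
  obtain ⟨C₂, hC₂⟩ := exp_mul_norm_Gamma_le hσ hm
  refine ⟨max C₁ C₂, δ, hδ, fun y => ?_⟩
  rw [Real.exp_neg, ← div_eq_mul_inv, le_div_iff₀ (Real.exp_pos _), mul_right_comm, ← Real.exp_add]
  rcases le_total 0 y with hy | hy
  · rw [abs_of_nonneg hy, ← add_mul]
    exact (hC₁ y).trans (le_max_left _ _)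
  · rw [abs_of_nonpos hy, mul_neg, ← sub_eq_add_neg, ← sub_mul]
    exact (hC₂ y).trans (le_max_right _ _)

lemma integrable_exp_neg_mul_abs {δ : ℝ} (hδ : 0 < δ) :
    Integrable fun x : ℝ => Real.exp (-(δ * |x|)) := by
  rw [← integrableOn_univ, ← Iic_union_Ioi (a := (0 : ℝ))]
  refine IntegrableOn.union ?_ ?_
  · refine (integrableOn_exp_mul_Iic hδ 0).congr_fun (fun x hx => ?_) measurableSet_Iic
    simp only
    rw [abs_of_nonpos hx, mul_neg, neg_neg]
  · refine (exp_neg_integrableOn_Ioi 0 hδ).congr_fun (fun x hx => ?_) measurableSet_Ioi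
    simp only
    rw [abs_of_pos hx, neg_mul]

end GammaOnLines

/-! ### Plancherel's identity for the Gamma function -/

section GammaPlancherel

open Complex Set
open scoped FourierTransform Topology

/-- **Plancherel's identity** for a continuous integrable function whose Fourier transform is
integrable. -/
theorem integral_norm_sq_fourier {h : ℝ → ℂ} (hc : Continuous h) (hi : Integrable h)
    (hF : Integrable (𝓕 h)) : ∫ ξ, ‖𝓕 h ξ‖ ^ 2 = ∫ u, ‖h u‖ ^ 2 := by
  have key := VectorFourier.integral_sesq_fourierIntegral_eq_neg_flip (innerSL ℂ (E := ℂ))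
    (L := innerₗ ℝ) Real.continuous_fourierChar (μ := volume) (ν := volume) continuous_inner hi hF
  have hinv : VectorFourier.fourierIntegral Real.fourierChar volume (-(innerₗ ℝ).flip) (𝓕 h) =
      h := by
    rw [← hc.fourierInv_fourier_eq hi hF]
    ext v
    simp [Real.fourierInv_eq, VectorFourier.fourierIntegral, hc.fourierInv_fourier_eq hi hF]
  rw [hinv] at key
  have hnorm : ∀ w : ℂ, innerSL ℂ w w = ((‖w‖ ^ 2 : ℝ) : ℂ) := fun w => by
    rw [innerSL_apply_apply, inner_self_eq_norm_sq_to_K]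
    simp
  change ∫ ξ, innerSL ℂ (𝓕 h ξ) (𝓕 h ξ) = ∫ x, innerSL ℂ (h x) (h x) at key
  simp_rw [hnorm] at key
  rw [integral_complex_ofReal, integral_complex_ofReal] at key
  exact_mod_cast key

/-- The substitution `t = exp (-u)` in a Mellin integral. -/
lemma MellinConvergent.integrable_comp_exp {f : ℝ → ℂ} {σ : ℝ} (hf : MellinConvergent f σ) :
    Integrable fun u : ℝ => Real.exp (-σ * u) • f (Real.exp (-u)) := by
  have h1 : ∀ x ∈ univ, HasDerivWithinAt (fun u : ℝ => Real.exp (-u)) (-Real.exp (-x)) univ x :=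
    fun x _ => by
      simpa using (hasDerivAt_neg x).exp.hasDerivWithinAt (s := univ)
  have h2 : InjOn (fun u : ℝ => Real.exp (-u)) univ := fun x _ y _ hxy => by simpa using hxy
  have h3 : (fun u : ℝ => Real.exp (-u)) '' univ = Ioi 0 := by
    rw [image_univ]
    ext t
    refine ⟨?_, fun ht => ⟨-Real.log t, by simp [Real.exp_log ht]⟩⟩
    rintro ⟨u, rfl⟩
    exact Real.exp_pos _
  rw [MellinConvergent, ← h3, integrableOn_image_iff_integrableOn_abs_deriv_smul
    MeasurableSet.univ h1 h2, integrableOn_univ] at hf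
  refine hf.congr (Eventually.of_forall fun u => ?_)
  simp only
  have h4 : (Real.exp (-u) : ℂ) ^ ((σ : ℂ) - 1) =
      ((Real.exp (-σ * u) / Real.exp (-u) : ℝ) : ℂ) := by
    rw [cpow_sub _ _ (by exact_mod_cast (Real.exp_pos _).ne'), cpow_one,
      ← ofReal_cpow (Real.exp_pos _).le, ← Real.exp_mul, neg_mul_comm, mul_comm u, ofReal_div]
  rw [abs_neg, abs_of_pos (Real.exp_pos _), h4, real_smul, real_smul, smul_eq_mul, ← mul_assoc,
    ← ofReal_mul, mul_div_cancel₀ _ (Real.exp_pos _).ne']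

lemma continuous_norm_Gamma_add_mul_I {σ : ℝ} (hσ : 0 < σ) :
    Continuous fun y : ℝ => ‖Gamma (σ + y * I)‖ := by
  refine continuous_iff_continuousAt.2 fun y => ContinuousAt.norm ?_
  refine ContinuousAt.comp (f := fun y : ℝ => (σ : ℂ) + y * I) (g := Gamma) ?_ (by fun_prop)
  refine (differentiableAt_Gamma _ fun m hm => ?_).continuousAt
  have h := congrArg re hm
  simp at h
  linarith [(Nat.cast_nonneg m : (0 : ℝ) ≤ m)]

lemma integrable_exp_mul_norm_Gamma_pow {σ : ℝ} (hσ : 0 < σ) {ψ : ℝ} (hψ : |ψ| < Real.pi / 2)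
    {n : ℕ} (hn : 0 < n) :
    Integrable fun y : ℝ => (Real.exp (ψ * y) * ‖Gamma (σ + y * I)‖) ^ n := by
  obtain ⟨C, δ, hδ, hC⟩ := exists_exp_mul_norm_Gamma_le hσ hψ
  refine ((integrable_exp_neg_mul_abs (δ := n * δ) (by positivity)).const_mul (C ^ n)).mono' ?_ ?_
  · have := continuous_norm_Gamma_add_mul_I hσ
    exact (by fun_prop : Continuous fun y : ℝ =>
      (Real.exp (ψ * y) * ‖Gamma (σ + y * I)‖) ^ n).aestronglyMeasurable
  · refine Eventually.of_forall fun y => ?_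
    rw [Real.norm_of_nonneg (by positivity)]
    refine (pow_le_pow_left₀ (by positivity) (hC y) n).trans_eq ?_
    rw [mul_pow, ← Real.exp_nat_mul]
    ring_nf

/-- Euler's integral after the substitution `t = exp (-u)`, read off from the Fourier transform at
frequency `0`. -/
lemma integral_exp_neg_mul_mul_exp_neg_exp {r b : ℝ} (hr : 0 < r) (hb : 0 < b) :
    ∫ u : ℝ, Real.exp (-r * u) * Real.exp (-(b * Real.exp (-u))) = b ^ (-r) * Real.Gamma r := by
  have h := mellin_exp_neg_mul (a := (r : ℂ)) (z := (b : ℂ)) (by simpa) (by simpa)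
  rw [mellin_eq_fourier] at h
  simp only [ofReal_re, ofReal_im, zero_div, Real.fourier_eq, inner_zero_right, neg_zero,
    AddChar.map_zero_eq_one, one_smul] at h
  have h2 : ∀ u : ℝ, Real.exp (-r * u) • cexp (-(b * Real.exp (-u))) =
      ((Real.exp (-r * u) * Real.exp (-(b * Real.exp (-u))) : ℝ) : ℂ) := fun u => by
    rw [real_smul]; push_cast; rfl
  simp_rw [h2] at h
  rw [integral_complex_ofReal, Gamma_ofReal, ← ofReal_neg, ← ofReal_cpow hb.le, ← ofReal_mul] at h
  exact_mod_cast h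

/-- The squared modulus of the Gamma function on a vertical line, exponentially tilted, is the
squared modulus of the Fourier transform of `u ↦ exp (-(r / 2) * u) * exp (-exp (ψ * I - u))`, so
that Plancherel's identity evaluates its integral. -/
theorem integral_exp_mul_norm_Gamma_sq {r : ℝ} (hr : 0 < r) {ψ : ℝ} (hψ : |ψ| < Real.pi / 2) :
    ∫ y : ℝ, (Real.exp (ψ * y) * ‖Gamma ((r / 2 : ℝ) + y * I)‖) ^ 2 =
      2 * Real.pi * ((2 * Real.cos ψ) ^ (-r) * Real.Gamma r) := by
  have hr2 : 0 < r / 2 := by positivity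
  have hcos : 0 < Real.cos ψ := Real.cos_pos_of_mem_Ioo (abs_lt.1 hψ)
  have hpi : (0 : ℝ) < 2 * Real.pi := by positivity
  set f : ℝ → ℂ := fun t => cexp (-(cexp (ψ * I) * t)) with hf
  set h : ℝ → ℂ := fun u => Real.exp (-(r / 2) * u) • f (Real.exp (-u)) with hh
  have hc : Continuous h := by simp only [hh, hf]; fun_prop
  have hi : Integrable h := MellinConvergent.integrable_comp_exp
    (mellinConvergent_exp_neg_mul (by simpa using hr) (exp_mul_I_re_pos hψ))
  -- at the frequency `ξ` the Fourier transform of `h` is the Mellin transform of `f` at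
  -- `r / 2 + 2 * π * ξ * I`
  have hFn : ∀ ξ : ℝ, ‖𝓕 h ξ‖ =
      Real.exp (ψ * (2 * Real.pi * ξ)) * ‖Gamma ((r / 2 : ℝ) + (2 * Real.pi * ξ : ℝ) * I)‖ := by
    intro ξ
    have h1 := norm_mellin_exp_neg_mul (a := (r / 2 : ℝ) + (2 * Real.pi * ξ : ℝ) * I)
      (by simpa using hr) hψ
    rw [mellin_eq_fourier] at h1
    have him : ((r / 2 : ℝ) + (2 * Real.pi * ξ : ℝ) * I : ℂ).im = 2 * Real.pi * ξ := by
      simp [-ofReal_mul, -ofReal_div]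
    have hre : ((r / 2 : ℝ) + (2 * Real.pi * ξ : ℝ) * I : ℂ).re = r / 2 := by
      simp [-ofReal_mul, -ofReal_div]
    rw [him, hre, mul_div_cancel_left₀ _ hpi.ne'] at h1
    exact h1
  have hF : Integrable (𝓕 h) := by
    have h1 := (integrable_exp_mul_norm_Gamma_pow hr2 hψ one_pos).comp_mul_left' hpi.ne'
    refine h1.mono' ?_ (Eventually.of_forall fun ξ => ?_)
    · exact (VectorFourier.fourierIntegral_continuous Real.continuous_fourierChar
        continuous_inner hi).aestronglyMeasurable
    · rw [hFn, pow_one]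
  have hP := integral_norm_sq_fourier hc hi hF
  simp_rw [hFn] at hP
  have hcomp := Measure.integral_comp_mul_left
    (fun y : ℝ => (Real.exp (ψ * y) * ‖Gamma ((r / 2 : ℝ) + y * I)‖) ^ 2) (2 * Real.pi)
  rw [hcomp, abs_of_pos (by positivity), smul_eq_mul] at hP
  rw [← integral_exp_neg_mul_mul_exp_neg_exp hr (b := 2 * Real.cos ψ) (by positivity),
    ← mul_inv_cancel_left₀ hpi.ne' (∫ y : ℝ, _), hP]
  congr 2
  ext u
  have hn : ‖h u‖ = Real.exp (-(r / 2) * u) * Real.exp (-(Real.cos ψ * Real.exp (-u))) := by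
    simp only [hh, hf]
    rw [norm_smul, Real.norm_of_nonneg (Real.exp_pos _).le, norm_exp, neg_re, re_mul_ofReal,
      exp_ofReal_mul_I_re]
  rw [hn, ← Real.exp_add, ← Real.exp_add, ← Real.exp_nat_mul]
  congr 1
  push_cast
  ring

end GammaPlancherel

/-! ### Measures with a density -/

section Density

lemma integrable_withDensity_ofReal_iff {f g : ℝ → ℝ} (hf : Measurable f) (h0 : ∀ x, 0 ≤ f x) :
    Integrable g (volume.withDensity fun x => ENNReal.ofReal (f x)) ↔
      Integrable fun x => f x * g x := by
  rw [integrable_withDensity_iff_integrable_smul' hf.ennreal_ofReal (by simp)]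
  simp [ENNReal.toReal_ofReal (h0 _)]

lemma integral_withDensity_ofReal {f : ℝ → ℝ} (hf : Measurable f) (h0 : ∀ x, 0 ≤ f x)
    (g : ℝ → ℝ) :
    ∫ x, g x ∂(volume.withDensity fun x => ENNReal.ofReal (f x)) = ∫ x, f x * g x := by
  rw [integral_withDensity_eq_integral_toReal_smul hf.ennreal_ofReal (by simp)]
  simp [ENNReal.toReal_ofReal (h0 _)]

end Density

/-! ### Moments of the generalized hyperbolic secant law -/

section GHS

open scoped Topology

variable {r l : ℝ}

lemma ghsPDFReal_nonneg (hr : 0 < r) (l x : ℝ) : 0 ≤ ghsPDFReal r l x := by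
  have := Real.Gamma_pos_of_pos hr
  unfold ghsPDFReal
  positivity

lemma measurable_ghsPDFReal (hr : 0 < r) (l : ℝ) : Measurable (ghsPDFReal r l) := by
  have h : ∀ x : ℝ, ((r : ℂ) + Complex.I * x) / 2 = (r / 2 : ℝ) + (x / 2 : ℝ) * Complex.I :=
    fun x => by push_cast; ring
  have h2 := (continuous_norm_Gamma_add_mul_I (half_pos hr)).comp
    (by fun_prop : Continuous fun x : ℝ => x / 2)
  simp only [Function.comp_def] at h2
  unfold ghsPDFReal
  simp_rw [h]
  exact Continuous.measurable (by fun_prop)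

/-- Tilting the density by `exp (t * x)` shifts the angle `arctan l` by `t`. -/
lemma ghsPDFReal_mul_exp (r l t x : ℝ) :
    ghsPDFReal r l x * Real.exp (t * x) =
      (2 : ℝ) ^ (r - 2) / (Real.pi * Real.Gamma r) * (1 + l ^ 2) ^ (-r / 2) *
        (Real.exp ((Real.arctan l + t) * (x / 2)) *
          ‖Complex.Gamma ((r / 2 : ℝ) + (x / 2 : ℝ) * Complex.I)‖) ^ 2 := by
  have h : ((r : ℂ) + Complex.I * x) / 2 = (r / 2 : ℝ) + (x / 2 : ℝ) * Complex.I := by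
    push_cast; ring
  have h2 : Real.exp ((Real.arctan l + t) * (x / 2)) ^ 2 =
      Real.exp (x * Real.arctan l) * Real.exp (t * x) := by
    rw [← Real.exp_nat_mul, ← Real.exp_add]
    congr 1
    push_cast
    ring
  rw [ghsPDFReal, h, mul_pow, h2]
  ring

lemma integrable_ghsPDFReal_mul_exp (hr : 0 < r) {t : ℝ}
    (ht : |Real.arctan l + t| < Real.pi / 2) :
    Integrable fun x => ghsPDFReal r l x * Real.exp (t * x) := by
  simp_rw [ghsPDFReal_mul_exp]
  exact ((integrable_exp_mul_norm_Gamma_pow (half_pos hr) ht two_pos).comp_div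
    two_ne_zero).const_mul _

lemma integral_ghsPDFReal_mul_exp (hr : 0 < r) {t : ℝ}
    (ht : |Real.arctan l + t| < Real.pi / 2) :
    ∫ x, ghsPDFReal r l x * Real.exp (t * x) =
      (1 + l ^ 2) ^ (-r / 2) * Real.cos (Real.arctan l + t) ^ (-r) := by
  have hcos : 0 < Real.cos (Real.arctan l + t) := Real.cos_pos_of_mem_Ioo (abs_lt.1 ht)
  have hG := Real.Gamma_pos_of_pos hr
  simp_rw [ghsPDFReal_mul_exp]
  rw [integral_const_mul, Measure.integral_comp_div
    (fun y : ℝ => (Real.exp ((Real.arctan l + t) * y) *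
      ‖Complex.Gamma ((r / 2 : ℝ) + y * Complex.I)‖) ^ 2), integral_exp_mul_norm_Gamma_sq hr ht,
    Real.mul_rpow two_pos.le hcos.le, Real.rpow_sub two_pos, Real.rpow_neg two_pos.le, abs_two]
  have h2 : (0 : ℝ) < 2 ^ r := by positivity
  simp only [smul_eq_mul, Real.rpow_two]
  field_simp

lemma one_add_sq_rpow_eq_cos_arctan (r l : ℝ) :
    (1 + l ^ 2 : ℝ) ^ (-r / 2) = Real.cos (Real.arctan l) ^ r := by
  rw [Real.cos_arctan, Real.sqrt_eq_rpow, one_div, Real.inv_rpow (by positivity),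
    ← Real.rpow_mul (by positivity), ← Real.rpow_neg (by positivity)]
  ring_nf

lemma integrable_ghsPDFReal (hr : 0 < r) (l : ℝ) : Integrable (ghsPDFReal r l) := by
  simpa using integrable_ghsPDFReal_mul_exp (t := 0) (l := l) hr
    (by simpa using abs_lt.2 ⟨Real.neg_pi_div_two_lt_arctan l, Real.arctan_lt_pi_div_two l⟩)

lemma integral_ghsPDFReal (hr : 0 < r) (l : ℝ) : ∫ x, ghsPDFReal r l x = 1 := by
  have h := integral_ghsPDFReal_mul_exp (t := 0) (l := l) hr
    (by simpa using abs_lt.2 ⟨Real.neg_pi_div_two_lt_arctan l, Real.arctan_lt_pi_div_two l⟩)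
  have hc := Real.cos_arctan_pos l
  rw [one_add_sq_rpow_eq_cos_arctan, add_zero, ← Real.rpow_add hc] at h
  simpa using h

/-- The functional equation of the Gamma function turns multiplication by `r ^ 2 + x ^ 2` into a
shift of the convolution parameter. -/
lemma ghsPDFReal_mul_sq_add_sq (hr : 0 < r) (l x : ℝ) :
    ghsPDFReal r l x * (r ^ 2 + x ^ 2) =
      r * (r + 1) * (1 + l ^ 2) * ghsPDFReal (r + 2) l x := by
  have hG := Real.Gamma_pos_of_pos hr
  have hΓ : Real.Gamma (r + 2) = (r + 1) * (r * Real.Gamma r) := by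
    rw [show r + 2 = r + 1 + 1 by ring, Real.Gamma_add_one (by positivity),
      Real.Gamma_add_one hr.ne']
  have ha : ((r : ℂ) + Complex.I * x) / 2 ≠ 0 := fun h => by
    have := congrArg Complex.re h
    simp at this
    exact hr.ne' this
  have hC : ‖Complex.Gamma ((((r + 2 : ℝ) : ℂ) + Complex.I * x) / 2)‖ ^ 2 =
      (r ^ 2 + x ^ 2) / 4 * ‖Complex.Gamma (((r : ℂ) + Complex.I * x) / 2)‖ ^ 2 := by
    rw [show (((r + 2 : ℝ) : ℂ) + Complex.I * x) / 2 = ((r : ℂ) + Complex.I * x) / 2 + 1 by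
      push_cast; ring, Complex.Gamma_add_one _ ha, norm_mul, mul_pow, ← Complex.normSq_eq_norm_sq]
    congr 1
    simp [Complex.normSq_apply]
    ring
  have hl : (0 : ℝ) < 1 + l ^ 2 := by positivity
  have hL : (1 + l ^ 2 : ℝ) ^ (-(r + 2) / 2) = (1 + l ^ 2) ^ (-r / 2) / (1 + l ^ 2) := by
    rw [show -(r + 2) / 2 = -r / 2 - 1 by ring, Real.rpow_sub_one hl.ne']
  have h2 : (2 : ℝ) ^ (r + 2 - 2) = 2 ^ (r - 2) * 4 := by
    rw [show r + 2 - 2 = r - 2 + 2 by ring, Real.rpow_add two_pos]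
    norm_num
  rw [ghsPDFReal, ghsPDFReal, hΓ, hC, hL, h2]
  field_simp

lemma integral_id_ghsMeasure (hr : 0 < r) (l : ℝ) : ∫ x, x ∂(ghsMeasure r l) = r * l := by
  have hm := measurable_ghsPDFReal hr l
  have h0 := ghsPDFReal_nonneg hr l
  have hc := Real.cos_arctan_pos l
  -- the moment generating function is finite and explicit near `0`
  have hnear : ∀ᶠ t : ℝ in 𝓝 0, |Real.arctan l + t| < Real.pi / 2 := by
    refine ContinuousAt.eventually_lt (f := fun t : ℝ => |Real.arctan l + t|) (by fun_prop)
      continuousAt_const ?_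
    simpa using abs_lt.2 ⟨Real.neg_pi_div_two_lt_arctan l, Real.arctan_lt_pi_div_two l⟩
  have hint : (0 : ℝ) ∈ interior (integrableExpSet id (ghsMeasure r l)) := by
    rw [mem_interior_iff_mem_nhds]
    filter_upwards [hnear] with t ht
    exact (integrable_withDensity_ofReal_iff hm h0).2 (integrable_ghsPDFReal_mul_exp hr ht)
  have hmgf : mgf id (ghsMeasure r l) =ᶠ[𝓝 0]
      fun t => Real.cos (Real.arctan l) ^ r * Real.cos (Real.arctan l + t) ^ (-r) := by
    filter_upwards [hnear] with t ht
    rw [← one_add_sq_rpow_eq_cos_arctan, ← integral_ghsPDFReal_mul_exp hr ht]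
    exact integral_withDensity_ofReal hm h0 _
  have h1 : HasDerivAt (fun t : ℝ => Real.cos (Real.arctan l + t))
      (-Real.sin (Real.arctan l)) 0 := by
    simpa using ((hasDerivAt_id (0 : ℝ)).const_add (Real.arctan l)).cos
  have h2 := (h1.rpow_const (p := -r) (Or.inl (by simpa using hc.ne'))).const_mul
    (Real.cos (Real.arctan l) ^ r)
  have h3 := (hasDerivAt_mgf hint).unique (h2.congr_of_eventuallyEq hmgf)
  have h4 : Real.cos (Real.arctan l) ^ r * Real.cos (Real.arctan l) ^ (-r - 1) =
      (Real.cos (Real.arctan l))⁻¹ := by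
    rw [← Real.rpow_add hc, show r + (-r - 1) = -1 by ring, Real.rpow_neg_one]
  simp only [id, zero_mul, Real.exp_zero, mul_one, add_zero] at h3
  rw [h3]
  calc _ = (Real.cos (Real.arctan l) ^ r * Real.cos (Real.arctan l) ^ (-r - 1)) *
        (r * Real.sin (Real.arctan l)) := by ring
    _ = r * Real.tan (Real.arctan l) := by rw [h4, Real.tan_eq_sin_div_cos]; ring
    _ = r * l := by rw [Real.tan_arctan]

/-- The shift expresses second moments through normalization. -/
lemma ghsPDFReal_mul_pow_two (hr : 0 < r) (l x : ℝ) :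
    ghsPDFReal r l x * x ^ 2 =
      r * (r + 1) * (1 + l ^ 2) * ghsPDFReal (r + 2) l x - r ^ 2 * ghsPDFReal r l x := by
  rw [← ghsPDFReal_mul_sq_add_sq hr]
  ring

lemma integral_sq_ghsMeasure (hr : 0 < r) (l : ℝ) :
    ∫ x, x ^ 2 ∂(ghsMeasure r l) = r * (r + 1) * (1 + l ^ 2) - r ^ 2 := by
  rw [ghsMeasure,
    integral_withDensity_ofReal (measurable_ghsPDFReal hr l) (ghsPDFReal_nonneg hr l)]
  simp_rw [ghsPDFReal_mul_pow_two hr]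
  rw [integral_sub ((integrable_ghsPDFReal (by positivity) l).const_mul _)
    ((integrable_ghsPDFReal hr l).const_mul _), integral_const_mul, integral_const_mul,
    integral_ghsPDFReal hr, integral_ghsPDFReal (by positivity)]
  ring

/-- Applying the shift twice bounds `x ^ 4` by a multiple of the density with parameter `r + 4`. -/
lemma ghsPDFReal_mul_pow_four_le (hr : 0 < r) (l x : ℝ) :
    ghsPDFReal r l x * x ^ 4 ≤
      r * (r + 1) * (r + 2) * (r + 3) * (1 + l ^ 2) ^ 2 * ghsPDFReal (r + 2 + 2) l x := by
  have h1 := ghsPDFReal_mul_sq_add_sq hr l x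
  have h2 := ghsPDFReal_mul_sq_add_sq (r := r + 2) (by positivity) l x
  have h0 := ghsPDFReal_nonneg hr l x
  calc ghsPDFReal r l x * x ^ 4
      ≤ ghsPDFReal r l x * ((r ^ 2 + x ^ 2) * ((r + 2) ^ 2 + x ^ 2)) := by
        gcongr
        nlinarith [sq_nonneg x, mul_nonneg (sq_nonneg r) (sq_nonneg x),
          mul_nonneg (sq_nonneg (r + 2)) (sq_nonneg x), mul_nonneg (sq_nonneg r)
          (sq_nonneg (r + 2))]
    _ = r * (r + 1) * (1 + l ^ 2) * (ghsPDFReal (r + 2) l x * ((r + 2) ^ 2 + x ^ 2)) := by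
        rw [← mul_assoc, h1]; ring
    _ = _ := by rw [h2]; ring

lemma integrable_pow_four_ghsMeasure (hr : 0 < r) (l : ℝ) :
    Integrable (fun x => x ^ 4) (ghsMeasure r l) := by
  refine (integrable_withDensity_ofReal_iff (measurable_ghsPDFReal hr l)
    (ghsPDFReal_nonneg hr l)).2 ?_
  refine ((integrable_ghsPDFReal (r := r + 2 + 2) (by positivity) l).const_mul
    (r * (r + 1) * (r + 2) * (r + 3) * (1 + l ^ 2) ^ 2)).mono' ?_ (Eventually.of_forall fun x => ?_)
  · exact ((measurable_ghsPDFReal hr l).mul (by fun_prop)).aestronglyMeasurable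
  · rw [Real.norm_of_nonneg (mul_nonneg (ghsPDFReal_nonneg hr l x) (by positivity))]
    exact ghsPDFReal_mul_pow_four_le hr l x

lemma integral_pow_four_ghsMeasure_le (hr : 0 < r) (l : ℝ) :
    ∫ x, x ^ 4 ∂(ghsMeasure r l) ≤ r * (r + 1) * (r + 2) * (r + 3) * (1 + l ^ 2) ^ 2 := by
  have hi := (integrable_withDensity_ofReal_iff (measurable_ghsPDFReal hr l)
    (ghsPDFReal_nonneg hr l)).1 (integrable_pow_four_ghsMeasure hr l)
  rw [ghsMeasure,
    integral_withDensity_ofReal (measurable_ghsPDFReal hr l) (ghsPDFReal_nonneg hr l)]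
  refine (integral_mono hi ((integrable_ghsPDFReal (r := r + 2 + 2) (by positivity) l).const_mul _)
    (ghsPDFReal_mul_pow_four_le hr l)).trans_eq ?_
  rw [integral_const_mul, integral_ghsPDFReal (by positivity), mul_one]

end GHS

/-! ### Factorial moments of the discrete laws -/

section FactorialMoments

lemma integrable_and_integral_eq_of_hasSum {μ : Measure ℕ} [IsFiniteMeasure μ] {f : ℕ → ℝ}
    (hf : ∀ k, 0 ≤ f k) {S : ℝ} (h : HasSum (fun k => μ.real {k} * f k) S) :
    Integrable f μ ∧ ∫ k, f k ∂μ = S := by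
  have hc : ∀ k, μ {k} ≠ ∞ := fun k => measure_ne_top _ _
  have hs : Summable fun k => (μ {k}).toReal * ‖f k‖ := by
    simpa only [Real.norm_of_nonneg (hf _), measureReal_def] using h.summable
  have h1 := (integrable_sum_dirac_iff (x := fun k : ℕ => k) hc).2 hs
  have h2 := hasSum_integral_sum_dirac (x := fun k : ℕ => k) hc hs
  rw [Measure.sum_smul_dirac] at h1 h2
  exact ⟨h1, h2.unique h⟩

/-- If `(k + 1) * w (k + 1) = c * w' k`, then the factorial moment of order `j + 1` of the weights
`w` is `c` times the factorial moment of order `j` of the weights `w'`. -/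
lemma HasSum.mul_descFactorial_succ {w w' : ℕ → ℝ} {c S : ℝ} {j : ℕ}
    (hw : ∀ k : ℕ, ((k : ℝ) + 1) * w (k + 1) = c * w' k)
    (h : HasSum (fun k => w' k * (k.descFactorial j : ℝ)) S) :
    HasSum (fun k => w k * (k.descFactorial (j + 1) : ℝ)) (c * S) := by
  rw [← hasSum_nat_add_iff' 1]
  simp only [Finset.range_one, Finset.sum_singleton, Nat.zero_descFactorial_succ, Nat.cast_zero,
    mul_zero, sub_zero]
  have hk : ∀ k : ℕ, w (k + 1) * ((k + 1).descFactorial (j + 1) : ℝ) =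
      c * (w' k * (k.descFactorial j : ℝ)) := fun k => by
    rw [Nat.succ_descFactorial_succ, ← mul_assoc, ← hw]
    push_cast
    ring
  simp_rw [hk]
  exact h.mul_left c

lemma Nat.cast_sq_eq_add_descFactorial (k : ℕ) :
    (k : ℝ) ^ 2 = k.descFactorial 2 + k.descFactorial 1 := by
  rcases k with _ | k
  · simp
  · simp [Nat.descFactorial_succ]
    ring

lemma Nat.cast_pow_four_eq_add_descFactorial (k : ℕ) :
    (k : ℝ) ^ 4 = k.descFactorial 4 + 6 * k.descFactorial 3 + 7 * k.descFactorial 2 +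
      k.descFactorial 1 := by
  rcases k with _ | _ | _ | k
  · simp
  · simp [Nat.descFactorial_succ]
  · simp [Nat.descFactorial_succ]; norm_num
  · simp [Nat.descFactorial_succ]
    ring

/-- Power moments from factorial moments; the coefficients are Stirling numbers of the second
kind. -/
lemma hasSum_mul_cast_of_descFactorial {w m : ℕ → ℝ}
    (h : ∀ j, HasSum (fun k => w k * (k.descFactorial j : ℝ)) (m j)) :
    HasSum (fun k : ℕ => w k * (k : ℝ)) (m 1) ∧
      HasSum (fun k : ℕ => w k * (k : ℝ) ^ 2) (m 2 + m 1) ∧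
      HasSum (fun k : ℕ => w k * (k : ℝ) ^ 4) (m 4 + 6 * m 3 + 7 * m 2 + m 1) := by
  refine ⟨by simpa using h 1, ?_, ?_⟩
  · convert (h 2).add (h 1) using 2 with k
    rw [Nat.cast_sq_eq_add_descFactorial]
    ring
  · convert (((h 4).add ((h 3).mul_left 6)).add ((h 2).mul_left 7)).add (h 1) using 2 with k
    rw [Nat.cast_pow_four_eq_add_descFactorial]
    ring

lemma moments_of_factorialMoments {μ : Measure ℕ} [IsFiniteMeasure μ] {m : ℕ → ℝ}
    (h : ∀ j, HasSum (fun k => μ.real {k} * (k.descFactorial j : ℝ)) (m j)) :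
    ∫ k : ℕ, (k : ℝ) ∂μ = m 1 ∧ ∫ k : ℕ, (k : ℝ) ^ 2 ∂μ = m 2 + m 1 ∧
      Integrable (fun k : ℕ => (k : ℝ) ^ 4) μ ∧
      ∫ k : ℕ, (k : ℝ) ^ 4 ∂μ = m 4 + 6 * m 3 + 7 * m 2 + m 1 := by
  obtain ⟨h1, h2, h4⟩ := hasSum_mul_cast_of_descFactorial h
  refine ⟨(integrable_and_integral_eq_of_hasSum (fun k => by positivity) h1).2,
    (integrable_and_integral_eq_of_hasSum (fun k => by positivity) h2).2,
    integrable_and_integral_eq_of_hasSum (fun k => by positivity) h4⟩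

lemma hasSum_binomial_descFactorial (n : ℕ) (p : unitInterval) (j : ℕ) :
    HasSum (fun k => (binomial n p).real {k} * (k.descFactorial j : ℝ))
      (n.descFactorial j * (p : ℝ) ^ j) := by
  induction j generalizing n with
  | zero =>
    have hc : ∀ k, binomial n p {k} ≠ ∞ := fun k => measure_ne_top _ _
    have h0 : Integrable (fun _ : ℕ => (1 : ℝ)) (binomial n p) := integrable_const _
    rw [← Measure.sum_smul_dirac (binomial n p)] at h0
    have h := hasSum_integral_sum_dirac (x := fun k : ℕ => k) hc
      ((integrable_sum_dirac_iff (x := fun k : ℕ => k) hc).1 h0)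
    rw [Measure.sum_smul_dirac] at h
    simpa [measureReal_def] using h
  | succ j ih =>
    rcases n with _ | n
    -- for `n = 0` the weights at `k + 1` vanish, so the shift holds with `c = 0`
    · have h := HasSum.mul_descFactorial_succ (w := fun k => (binomial 0 p).real {k}) (c := 0)
        (fun k => by simp [binomial_real_singleton]) (ih 0)
      simpa using h
    · have h := HasSum.mul_descFactorial_succ (w := fun k => (binomial (n + 1) p).real {k})
        (c := (n + 1) * p) (fun k => ?_) (ih n)
      · convert h using 1
        rw [Nat.succ_descFactorial_succ]
        push_cast
        ring
      · have hc : ((n : ℝ) + 1) * (n.choose k : ℝ) = ((n + 1).choose (k + 1) : ℝ) * (k + 1) := by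
          exact_mod_cast Nat.add_one_mul_choose_eq n k
        simp only [binomial_real_singleton, Nat.add_sub_add_right]
        linear_combination -(p : ℝ) ^ (k + 1) * (1 - p : ℝ) ^ (n - k) * hc

lemma hasSum_poisson_descFactorial (r : NNReal) (j : ℕ) :
    HasSum (fun k => (poissonMeasure r).real {k} * (k.descFactorial j : ℝ)) ((r : ℝ) ^ j) := by
  simp_rw [poissonMeasure_real_singleton]
  induction j with
  | zero => simpa using hasSum_one_poissonMeasure r
  | succ j ih =>
    rw [pow_succ']
    refine HasSum.mul_descFactorial_succ (fun k => ?_) ih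
    rw [Nat.factorial_succ]
    push_cast
    field_simp
    ring

lemma factorial_mul_choose_add_sub_one (r : ℝ) (k : ℕ) :
    (k.factorial : ℝ) * Ring.choose (r + k - 1) k = (ascPochhammer ℝ k).eval r := by
  rw [← Ring.multichoose_eq, ← nsmul_eq_mul, Ring.factorial_nsmul_multichoose_eq_ascPochhammer,
    Polynomial.ascPochhammer_smeval_eq_eval]

lemma negBinomialMeasure_real_singleton {r p : ℝ} (hr : 0 < r) (hp : p ∈ Set.Ioo (0 : ℝ) 1)
    (k : ℕ) : (negBinomialMeasure r p).real {k} =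
      Ring.choose (r + (k : ℝ) - 1) k * p ^ k * (1 - p) ^ r := by
  rw [measureReal_def, negBinomialMeasure, Measure.sum_smul_dirac_singleton,
    ENNReal.toReal_ofReal]
  have h1 := factorial_mul_choose_add_sub_one r k
  have h2 := ascPochhammer_pos k r hr
  rw [← h1] at h2
  have h3 := pos_of_mul_pos_right h2 (by positivity)
  have := hp.1
  have : 0 < 1 - p := sub_pos.2 hp.2
  positivity

/-- The negative binomial weights sum to one by the binomial series of `(1 - p) ^ (-r)`. -/
lemma hasSum_negBinomial {r p : ℝ} (hp : p ∈ Set.Ioo (0 : ℝ) 1) :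
    HasSum (fun k : ℕ => Ring.choose (r + (k : ℝ) - 1) k * p ^ k * (1 - p) ^ r) 1 := by
  have h1 : 0 < 1 - p := sub_pos.2 hp.2
  have h := (Real.one_div_one_sub_rpow_hasFPowerSeriesOnBall_zero r).hasSum (y := p) (by
    rw [Metric.mem_eball, edist_zero_right, Real.enorm_of_nonneg hp.1.le]
    exact ENNReal.ofReal_lt_one.2 hp.2)
  have h2 : (0 : ℝ) < (1 - p) ^ r := by positivity
  have h3 := h.mul_right ((1 - p) ^ r)
  simp_rw [mul_comm (Ring.choose _ _) (p ^ _)]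
  simpa [FormalMultilinearSeries.ofScalars_apply_eq, h2.ne'] using h3

lemma hasSum_negBinomial_descFactorial {r p : ℝ} (hp : p ∈ Set.Ioo (0 : ℝ) 1) (j : ℕ) :
    HasSum (fun k : ℕ => Ring.choose (r + (k : ℝ) - 1) k * p ^ k * (1 - p) ^ r *
      (k.descFactorial j : ℝ)) ((ascPochhammer ℝ j).eval r * (p / (1 - p)) ^ j) := by
  have h1 : 0 < 1 - p := sub_pos.2 hp.2
  induction j generalizing r with
  | zero => simpa using hasSum_negBinomial hp
  | succ j ih =>
    have h := HasSum.mul_descFactorial_succ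
      (w := fun k : ℕ => Ring.choose (r + (k : ℝ) - 1) k * p ^ k * (1 - p) ^ r)
      (c := r * (p / (1 - p))) (fun k => ?_) (ih (r := r + 1))
    · convert h using 1
      rw [ascPochhammer_succ_left]
      simp
      ring
    · have hc : ((k : ℝ) + 1) * Ring.choose (r + ((k + 1 : ℕ) : ℝ) - 1) (k + 1) =
          r * Ring.choose (r + 1 + (k : ℝ) - 1) k := by
        have ha := factorial_mul_choose_add_sub_one r (k + 1)
        have hb := factorial_mul_choose_add_sub_one (r + 1) k
        rw [ascPochhammer_succ_left, Nat.factorial_succ] at ha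
        simp only [Polynomial.eval_mul, Polynomial.eval_X, Polynomial.eval_comp,
          Polynomial.eval_add, Polynomial.eval_one] at ha
        rw [← hb] at ha
        have hk : (k.factorial : ℝ) ≠ 0 := by positivity
        apply mul_left_cancel₀ hk
        push_cast at ha ⊢
        linear_combination ha
      rw [Real.rpow_add_one h1.ne']
      field_simp
      linear_combination p ^ (k + 1) * hc

end FactorialMoments

/-! ### Moments of the gamma law -/

section Gamma

variable {a r : ℝ}

lemma integrable_gammaPDFReal (ha : 0 < a) (hr : 0 < r) : Integrable (gammaPDFReal a r) := by
  refine ⟨(measurable_gammaPDFReal a r).aestronglyMeasurable, ?_⟩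
  rw [hasFiniteIntegral_iff_ofReal (Eventually.of_forall (gammaPDFReal_nonneg ha hr))]
  exact (lintegral_gammaPDF_eq_one ha hr).trans_lt ENNReal.one_lt_top

lemma integral_gammaPDFReal (ha : 0 < a) (hr : 0 < r) : ∫ x, gammaPDFReal a r x = 1 := by
  rw [integral_eq_lintegral_of_nonneg_ae (Eventually.of_forall (gammaPDFReal_nonneg ha hr))
    (measurable_gammaPDFReal a r).aestronglyMeasurable]
  change (∫⁻ x, gammaPDF a r x).toReal = 1
  rw [lintegral_gammaPDF_eq_one ha hr, ENNReal.toReal_one]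

/-- The case `x = 0` needs `a ≠ 0`: then the right-hand side contains `0 ^ a = 0`. -/
lemma gammaPDFReal_mul_self (ha : 0 < a) (hr : 0 < r) (x : ℝ) :
    gammaPDFReal a r x * x = a / r * gammaPDFReal (a + 1) r x := by
  have hG := Real.Gamma_pos_of_pos ha
  unfold gammaPDFReal
  split_ifs with hx
  · rcases hx.eq_or_lt with rfl | hx
    · simp [Real.zero_rpow ha.ne']
    · rw [Real.Gamma_add_one ha.ne', Real.rpow_add_one hr.ne', add_sub_cancel_right,
        Real.rpow_sub_one hx.ne']
      field_simp
  · simp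

lemma gammaPDFReal_mul_pow (ha : 0 < a) (hr : 0 < r) (x : ℝ) (k : ℕ) :
    gammaPDFReal a r x * x ^ k =
      (ascPochhammer ℝ k).eval a / r ^ k * gammaPDFReal (a + k) r x := by
  induction k generalizing a with
  | zero => simp
  | succ k ih =>
    rw [pow_succ', ← mul_assoc, gammaPDFReal_mul_self ha hr, mul_assoc, ih (by positivity),
      ascPochhammer_succ_left]
    simp only [Polynomial.eval_mul, Polynomial.eval_X, Polynomial.eval_comp,
          Polynomial.eval_add, Polynomial.eval_one]
    push_cast
    rw [add_right_comm, add_assoc a]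
    field_simp
    ring

lemma integrable_pow_gammaMeasure (ha : 0 < a) (hr : 0 < r) (k : ℕ) :
    Integrable (fun x => x ^ k) (gammaMeasure a r) := by
  refine (integrable_withDensity_ofReal_iff (measurable_gammaPDFReal a r)
    (gammaPDFReal_nonneg ha hr)).2 ?_
  simp_rw [gammaPDFReal_mul_pow ha hr]
  exact (integrable_gammaPDFReal (by positivity) hr).const_mul _

lemma integral_pow_gammaMeasure (ha : 0 < a) (hr : 0 < r) (k : ℕ) :
    ∫ x, x ^ k ∂(gammaMeasure a r) = (ascPochhammer ℝ k).eval a / r ^ k := by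
  refine (integral_withDensity_ofReal (measurable_gammaPDFReal a r)
    (gammaPDFReal_nonneg ha hr) _).trans ?_
  simp_rw [gammaPDFReal_mul_pow ha hr]
  rw [integral_const_mul, integral_gammaPDFReal (by positivity) hr, mul_one]

end Gamma

/-! ### The conditions in terms of moments -/

section Conditions

variable {Ω : Type*} [MeasurableSpace Ω] {P : Measure Ω}

lemma exists_eventually_sum_le {q : ℕ → ℝ} (hq0 : ∀ i, 0 ≤ q i)
    (hq : (fun p : ℕ => ∑ i ∈ Finset.range p, q i) =O[atTop] (fun p : ℕ => (p : ℝ))) :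
    ∃ C : ℝ, 0 ≤ C ∧ ∀ᶠ p : ℕ in atTop, 0 < p ∧
      ∑ i ∈ Finset.range p, ENNReal.ofReal (q i) ≤ ENNReal.ofReal C * p := by
  obtain ⟨C, hC0, hC⟩ := hq.exists_nonneg
  refine ⟨C, hC0, ?_⟩
  filter_upwards [hC.bound, eventually_gt_atTop 0] with p hp hp0
  refine ⟨hp0, ?_⟩
  rw [← ENNReal.ofReal_sum_of_nonneg fun i _ => hq0 i, ← ENNReal.ofReal_natCast,
    ← ENNReal.ofReal_mul hC0]
  refine ENNReal.ofReal_le_ofReal ((le_abs_self _).trans ?_)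
  simpa using hp

lemma limsup_sum_div_lt_top {a : ℕ → ℝ≥0∞} {q : ℕ → ℝ} (hq0 : ∀ i, 0 ≤ q i)
    (hq : (fun p : ℕ => ∑ i ∈ Finset.range p, q i) =O[atTop] (fun p : ℕ => (p : ℝ)))
    (ha : ∀ i, a i ≤ ENNReal.ofReal (q i)) :
    limsup (fun p : ℕ => (∑ i ∈ Finset.range p, a i) / (p : ℝ≥0∞)) atTop < ∞ := by
  obtain ⟨C, -, hC⟩ := exists_eventually_sum_le hq0 hq
  refine (limsup_le_of_le (h := ?_)).trans_lt (ENNReal.ofReal_lt_top (r := C))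
  filter_upwards [hC] with p ⟨_, hp⟩
  exact ENNReal.div_le_of_le_mul ((Finset.sum_le_sum fun i _ => ha i).trans hp)

lemma ENNReal.sum_rpow_le_rpow_sum {ι : Type*} (s : Finset ι) (f : ι → ℝ≥0∞) {x : ℝ}
    (hx : 1 ≤ x) : ∑ i ∈ s, f i ^ x ≤ (∑ i ∈ s, f i) ^ x := by
  classical
  induction s using Finset.induction_on with
  | empty => simp
  | insert i s hi ih =>
    rw [Finset.sum_insert hi, Finset.sum_insert hi]
    exact (add_le_add le_rfl ih).trans (ENNReal.add_rpow_le_rpow_add _ _ hx)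

/-- The maximum of `Y i ^ 2` is at most the square root of the sum of the `Y i ^ 4`, and expectation
and square root are exchanged by Jensen's inequality. -/
lemma lintegral_sup_sq_le [IsProbabilityMeasure P] {Y : ℕ → Ω → ℝ}
    (hY : ∀ i, AEMeasurable (Y i) P) (p : ℕ) :
    ∫⁻ ω, (Finset.range p).sup (fun i => ENNReal.ofReal (Y i ω ^ 2)) ∂P ≤
      (∑ i ∈ Finset.range p, ∫⁻ ω, ENNReal.ofReal (Y i ω ^ 4) ∂P) ^ (1 / 2 : ℝ) := by
  set S : Ω → ℝ≥0∞ := fun ω => ∑ i ∈ Finset.range p, ENNReal.ofReal (Y i ω ^ 4)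
  have hS : AEMeasurable S P :=
    Finset.aemeasurable_fun_sum _ fun i _ => ((hY i).pow_const 4).ennreal_ofReal
  have h1 : ∀ ω, (Finset.range p).sup (fun i => ENNReal.ofReal (Y i ω ^ 2)) ≤
      S ω ^ (1 / 2 : ℝ) := by
    refine fun ω => Finset.sup_le fun i hi => ?_
    have h2 : ENNReal.ofReal (Y i ω ^ 2) = ENNReal.ofReal (Y i ω ^ 4) ^ (1 / 2 : ℝ) := by
      rw [ENNReal.ofReal_rpow_of_nonneg (by positivity) (by norm_num), ← Real.sqrt_eq_rpow,
        show Y i ω ^ 4 = (Y i ω ^ 2) ^ 2 by ring, Real.sqrt_sq (by positivity)]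
    rw [h2]
    gcongr
    exact Finset.single_le_sum (f := fun i => ENNReal.ofReal (Y i ω ^ 4))
      (fun _ _ => zero_le) hi
  have h3 := ENNReal.lintegral_mul_le_Lp_mul_Lq P Real.HolderConjugate.two_two
    (hS.pow_const (1 / 2 : ℝ)) (aemeasurable_const (b := (1 : ℝ≥0∞)))
  have h4 : ∀ ω, (S ω ^ (1 / 2 : ℝ)) ^ (2 : ℝ) = S ω := fun ω => by
    rw [← ENNReal.rpow_mul]; norm_num
  simp only [Pi.mul_apply, mul_one, h4, ENNReal.one_rpow, lintegral_const, measure_univ] at h3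
  rw [← lintegral_finsetSum' _ fun i _ => ((hY i).pow_const 4).ennreal_ofReal]
  exact (lintegral_mono h1).trans h3

lemma evariance_eq_ofReal_sub [IsProbabilityMeasure P] {X : Ω → ℝ} (hX : MemLp X 2 P) :
    evariance X P = ENNReal.ofReal (∫ ω, X ω ^ 2 ∂P - (∫ ω, X ω ∂P) ^ 2) := by
  rw [← ofReal_variance hX, variance_eq_sub hX]
  rfl

lemma memLp_two_of_integrable_pow_four [IsFiniteMeasure P] {X : Ω → ℝ} (hX : AEMeasurable X P)
    (h4 : Integrable (fun ω => X ω ^ 4) P) :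
    MemLp X 2 P ∧ MemLp (fun ω => X ω ^ 2) 2 P := by
  have h : MemLp (fun ω => X ω ^ 2) 2 P := by
    rw [memLp_two_iff_integrable_sq (hX.pow_const 2).aestronglyMeasurable]
    simpa only [← pow_mul] using h4
  refine ⟨?_, h⟩
  rw [memLp_two_iff_integrable_sq hX.aestronglyMeasurable]
  exact h.integrable one_le_two

/-- All conditions follow from the first, second and fourth moments, once the latter are controlled
by a sequence `q` with bounded averages. For the maximum, the weaker bound `q i ^ (4 / 3)` on the
fourth moments suffices, since it leads to `O(p ^ (2 / 3))`. -/
theorem regularity_of_moments [IsProbabilityMeasure P] {ν₀ ν₁ ν₂ : ℝ} {τ θ q : ℕ → ℝ}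
    {Y : ℕ → Ω → ℝ} (hτ : ∀ i, 0 < τ i) (hY : ∀ i, AEMeasurable (Y i) P)
    (hint : ∀ i, Integrable (fun ω => Y i ω ^ 4) P) (hmean : ∀ i, ∫ ω, Y i ω ∂P = θ i)
    (hsq : ∀ i, ∫ ω, Y i ω ^ 2 ∂P = θ i ^ 2 + (ν₀ + ν₁ * θ i + ν₂ * θ i ^ 2) / τ i)
    (hD : (∀ i, τ i + ν₂ ≠ 0) ∧ BddAbove (Set.range fun i => (τ i / (τ i + ν₂)) ^ 2) ∧
      BddAbove (Set.range fun i => (ν₁ / (τ i + ν₂)) ^ 2))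
    (hq : (fun p : ℕ => ∑ i ∈ Finset.range p, q i) =O[atTop] (fun p : ℕ => (p : ℝ)))
    (hqA : ∀ i, (ν₀ + ν₁ * θ i + ν₂ * θ i ^ 2) / τ i ≤ q i)
    (hqB : ∀ i, (ν₀ + ν₁ * θ i + ν₂ * θ i ^ 2) / τ i * θ i ^ 2 ≤ q i)
    (hqC : ∀ i, ∫ ω, Y i ω ^ 4 ∂P - (∫ ω, Y i ω ^ 2 ∂P) ^ 2 ≤ q i)
    (hqE : ∀ i, ∫ ω, Y i ω ^ 4 ∂P ≤ q i ^ (4 / 3 : ℝ)) :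
    HasQuadraticVariance ν₀ ν₁ ν₂ τ θ Y P ∧ RegularityConditions ν₁ ν₂ τ θ Y P := by
  have hL := fun i => memLp_two_of_integrable_pow_four (hY i) (hint i)
  have hvar : ∀ i, evariance (Y i) P =
      ENNReal.ofReal ((ν₀ + ν₁ * θ i + ν₂ * θ i ^ 2) / τ i) := fun i => by
    rw [evariance_eq_ofReal_sub (hL i).1, hmean, hsq, add_sub_cancel_left]
  have hV0 : ∀ i, 0 ≤ (ν₀ + ν₁ * θ i + ν₂ * θ i ^ 2) / τ i := fun i => by
    have h := variance_nonneg (Y i) P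
    have h2 := variance_eq_sub (hL i).1
    simp only [Pi.pow_apply] at h2
    rw [hmean, hsq, add_sub_cancel_left] at h2
    rwa [h2] at h
  have hq0 : ∀ i, 0 ≤ q i := fun i => (hV0 i).trans (hqA i)
  refine ⟨⟨hτ, fun i => (hL i).1.integrable one_le_two, hmean, fun i => ?_, hvar⟩,
    ⟨?_, ?_, ?_, hD, ?_⟩⟩
  · have h := mul_nonneg (hV0 i) (hτ i).le
    rwa [div_mul_cancel₀ _ (hτ i).ne'] at h
  · refine limsup_sum_div_lt_top hq0 hq fun i => ?_
    rw [hvar]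
    exact ENNReal.ofReal_le_ofReal (hqA i)
  · refine limsup_sum_div_lt_top hq0 hq fun i => ?_
    rw [hvar, ← ENNReal.ofReal_mul (hV0 i)]
    exact ENNReal.ofReal_le_ofReal (hqB i)
  · refine limsup_sum_div_lt_top hq0 hq fun i => ?_
    rw [evariance_eq_ofReal_sub (hL i).2]
    simp_rw [← pow_mul]
    exact ENNReal.ofReal_le_ofReal (hqC i)
  · refine ⟨1 / 3, by norm_num, ?_⟩
    obtain ⟨C, hC0, hC⟩ := exists_eventually_sum_le hq0 hq
    refine (limsup_le_of_le (h := ?_)).trans_lt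
      (ENNReal.rpow_lt_top_of_nonneg (x := ENNReal.ofReal C) (y := 2 / 3) (by norm_num)
        ENNReal.ofReal_ne_top)
    -- the exponents combine to `(4 / 3) * (1 / 2) = 2 / 3 = 1 - 1 / 3`
    filter_upwards [hC] with p ⟨hp0, hp⟩
    refine ENNReal.div_le_of_le_mul ((lintegral_sup_sq_le hY p).trans ?_)
    have h1 : ∀ i, ∫⁻ ω, ENNReal.ofReal (Y i ω ^ 4) ∂P ≤ ENNReal.ofReal (q i) ^ (4 / 3 : ℝ) := by
      intro i
      rw [← ofReal_integral_eq_lintegral_ofReal (hint i)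
        (Eventually.of_forall fun ω => by positivity),
        ENNReal.ofReal_rpow_of_nonneg (hq0 i) (by norm_num)]
      exact ENNReal.ofReal_le_ofReal (hqE i)
    calc (∑ i ∈ Finset.range p, ∫⁻ ω, ENNReal.ofReal (Y i ω ^ 4) ∂P) ^ (1 / 2 : ℝ)
        ≤ ((∑ i ∈ Finset.range p, ENNReal.ofReal (q i)) ^ (4 / 3 : ℝ)) ^ (1 / 2 : ℝ) := by
          gcongr
          exact (Finset.sum_le_sum fun i _ => h1 i).trans
            (ENNReal.sum_rpow_le_rpow_sum _ _ (by norm_num))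
      _ ≤ ((ENNReal.ofReal C * p) ^ (4 / 3 : ℝ)) ^ (1 / 2 : ℝ) := by gcongr
      _ = ENNReal.ofReal C ^ (2 / 3 : ℝ) * (p : ℝ≥0∞) ^ (1 - 1 / 3 : ℝ) := by
          rw [← ENNReal.rpow_mul, ENNReal.mul_rpow_of_nonneg _ _ (by norm_num)]
          norm_num

/-- If the fourth moments themselves have bounded averages, then so have all other quantities, since
`Var(Y) ≤ E(Y ^ 2)` and `Var(Y) * E(Y) ^ 2 ≤ E(Y ^ 2) ^ 2 ≤ E(Y ^ 4)`. -/
theorem regularity_of_fourth_moment_le [IsProbabilityMeasure P] {ν₀ ν₁ ν₂ : ℝ} {τ θ q : ℕ → ℝ}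
    {Y : ℕ → Ω → ℝ} (hτ : ∀ i, 0 < τ i) (hY : ∀ i, AEMeasurable (Y i) P)
    (hint : ∀ i, Integrable (fun ω => Y i ω ^ 4) P) (hmean : ∀ i, ∫ ω, Y i ω ∂P = θ i)
    (hsq : ∀ i, ∫ ω, Y i ω ^ 2 ∂P = θ i ^ 2 + (ν₀ + ν₁ * θ i + ν₂ * θ i ^ 2) / τ i)
    (hD : (∀ i, τ i + ν₂ ≠ 0) ∧ BddAbove (Set.range fun i => (τ i / (τ i + ν₂)) ^ 2) ∧
      BddAbove (Set.range fun i => (ν₁ / (τ i + ν₂)) ^ 2))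
    (hq : (fun p : ℕ => ∑ i ∈ Finset.range p, q i) =O[atTop] (fun p : ℕ => (p : ℝ)))
    (hq1 : ∀ i, 1 ≤ q i) (hqY : ∀ i, ∫ ω, Y i ω ^ 4 ∂P ≤ q i) :
    HasQuadraticVariance ν₀ ν₁ ν₂ τ θ Y P ∧ RegularityConditions ν₁ ν₂ τ θ Y P := by
  have hL := fun i => memLp_two_of_integrable_pow_four (hY i) (hint i)
  have h24 : ∀ i, (∫ ω, Y i ω ^ 2 ∂P) ^ 2 ≤ ∫ ω, Y i ω ^ 4 ∂P := fun i => by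
    have h := variance_nonneg (fun ω => Y i ω ^ 2) P
    rw [variance_eq_sub (hL i).2] at h
    simpa [← pow_mul] using h
  have h2 : ∀ i, ∫ ω, Y i ω ^ 2 ∂P ≤ q i := fun i => by
    nlinarith [h24 i, hqY i, hq1 i, sq_nonneg (∫ ω, Y i ω ^ 2 ∂P - 1)]
  refine regularity_of_moments hτ hY hint hmean hsq hD hq (fun i => ?_) (fun i => ?_)
    (fun i => ?_) (fun i => ?_)
  · linarith [hsq i, h2 i, sq_nonneg (θ i)]
  · refine le_trans ?_ ((h24 i).trans (hqY i))
    rw [hsq]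
    nlinarith [sq_nonneg ((ν₀ + ν₁ * θ i + ν₂ * θ i ^ 2) / τ i), sq_nonneg (θ i ^ 2),
      integral_nonneg (μ := P) (f := fun ω => Y i ω ^ 2) (fun ω => sq_nonneg _), hsq i]
  · linarith [hqY i, sq_nonneg (∫ ω, Y i ω ^ 2 ∂P)]
  · exact (hqY i).trans (Real.self_le_rpow_of_one_le (hq1 i) (by norm_num))

/-- For `ν₂ ≥ 0` the condition on the quotients holds as soon as the `τ i` are bounded away
from `0`. -/
lemma condD_of_le {c ν₁ ν₂ : ℝ} {τ : ℕ → ℝ} (hc : 0 < c) (hτ : ∀ i, c ≤ τ i) (hν₂ : 0 ≤ ν₂) :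
    (∀ i, τ i + ν₂ ≠ 0) ∧ BddAbove (Set.range fun i => (τ i / (τ i + ν₂)) ^ 2) ∧
      BddAbove (Set.range fun i => (ν₁ / (τ i + ν₂)) ^ 2) := by
  have h0 : ∀ i, 0 < τ i := fun i => hc.trans_le (hτ i)
  refine ⟨fun i => by linarith [h0 i], ⟨1, ?_⟩, ⟨(ν₁ / c) ^ 2, ?_⟩⟩
  · rintro _ ⟨i, rfl⟩
    have := h0 i
    refine pow_le_one₀ (by positivity) ((div_le_one (by positivity)).2 (by linarith))
  · rintro _ ⟨i, rfl⟩
    have := h0 i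
    simp only [div_pow]
    gcongr
    linarith [hτ i]

lemma isBigO_sum_const_mul_one_add {f : ℕ → ℝ} (C : ℝ)
    (hf : (fun p : ℕ => ∑ i ∈ Finset.range p, f i) =O[atTop] (fun p : ℕ => (p : ℝ))) :
    (fun p : ℕ => ∑ i ∈ Finset.range p, C * (1 + f i)) =O[atTop] (fun p : ℕ => (p : ℝ)) := by
  have h : (fun p : ℕ => ∑ i ∈ Finset.range p, C * (1 + f i)) =
      fun p : ℕ => C * ((p : ℝ) + ∑ i ∈ Finset.range p, f i) := by
    ext p
    rw [← Finset.mul_sum, Finset.sum_add_distrib]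
    simp
  rw [h]
  exact ((isBigO_refl _ _).add hf).const_mul_left C

variable {𝓧 : Type*} [MeasurableSpace 𝓧] {μ : Measure 𝓧} {g : 𝓧 → ℝ} {X : Ω → ℝ} {τ : ℝ}

lemma ProbabilityTheory.HasLaw.integral_pow_of_map_div (hg : Measurable g)
    (hX : HasLaw X (μ.map fun x => g x / τ) P) (k : ℕ) :
    ∫ ω, X ω ^ k ∂P = (∫ x, g x ^ k ∂μ) / τ ^ k := by
  have h := hX.integral_comp (f := fun y : ℝ => y ^ k) (by fun_prop)
  rw [integral_map (hg.div_const τ).aemeasurable (by fun_prop)] at h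
  simp only [div_pow] at h
  rw [integral_div] at h
  exact h

lemma ProbabilityTheory.HasLaw.integrable_pow_of_map_div (hg : Measurable g)
    (hX : HasLaw X (μ.map fun x => g x / τ) P) {k : ℕ} (h : Integrable (fun x => g x ^ k) μ) :
    Integrable (fun ω => X ω ^ k) P := by
  have h1 : Integrable (fun y : ℝ => y ^ k) (P.map X) := by
    rw [hX.map_eq, integrable_map_measure (by fun_prop) (hg.div_const τ).aemeasurable]
    simp only [Function.comp_def, div_pow]
    exact h.div_const _
  exact h1.comp_aemeasurable hX.aemeasurable

lemma ProbabilityTheory.HasLaw.isProbabilityMeasure_of_map_div [IsProbabilityMeasure P]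
    (hg : Measurable g) (hX : HasLaw X (μ.map fun x => g x / τ) P) : IsProbabilityMeasure μ := by
  have h1 : IsProbabilityMeasure (μ.map fun x => g x / τ) := by
    rw [← hX.map_eq]
    exact Measure.isProbabilityMeasure_map hX.aemeasurable
  exact (Measure.isProbabilityMeasure_map_iff (hg.div_const τ).aemeasurable).1 h1

end Conditions

/-! ### The five families -/

section Families

variable {Ω : Type*} [MeasurableSpace Ω] {P : Measure Ω} [IsProbabilityMeasure P] {Y : ℕ → Ω → ℝ}

lemma exists_pos_le_of_iInf_pos {u : ℕ → ℝ} (h : 0 < ⨅ i, u i) : ∃ c, 0 < c ∧ ∀ i, c ≤ u i := by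
  refine ⟨_, h, fun i => ciInf_le ?_ i⟩
  -- an unbounded family of reals has infimum `0`
  by_contra hb
  rw [Real.iInf_of_not_bddBelow hb] at h
  exact lt_irrefl _ h

lemma pow_le_one_add_pow {x : ℝ} (hx : 0 ≤ x) {k m : ℕ} (hk : k ≤ m) : x ^ k ≤ 1 + x ^ m := by
  rcases le_total x 1 with h | h
  · linarith [pow_le_one₀ (n := k) hx h, pow_nonneg hx m]
  · linarith [pow_le_pow_right₀ h hk]

/-- Here `0 ≤ Y i ≤ 1` almost surely, so the fourth moments are at most one. -/
theorem regularity_binomial {n : ℕ → ℕ} {π : ℕ → unitInterval}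
    (hY : ∀ i, HasLaw (Y i)
      ((binomial (n i) (π i)).map fun k : ℕ => (k : ℝ) / (n i : ℝ)) P)
    (hn : ∀ i, 2 ≤ n i) :
    HasQuadraticVariance 0 1 (-1) (fun i => (n i : ℝ)) (fun i => (π i : ℝ)) Y P ∧
      RegularityConditions 1 (-1) (fun i => (n i : ℝ)) (fun i => (π i : ℝ)) Y P := by
  have hn2 : ∀ i, (2 : ℝ) ≤ n i := fun i => by exact_mod_cast hn i
  have hn0 : ∀ i, (0 : ℝ) < n i := fun i => by linarith [hn2 i]
  have hg : Measurable fun k : ℕ => (k : ℝ) := by fun_prop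
  have hm := fun i => moments_of_factorialMoments (hasSum_binomial_descFactorial (n i) (π i))
  have hpow := fun i k => (hY i).integral_pow_of_map_div hg k
  have hint : ∀ i, Integrable (fun ω => Y i ω ^ 4) P := fun i =>
    (hY i).integrable_pow_of_map_div hg (hm i).2.2.1
  have hle : ∀ i, ∀ᵐ ω ∂P, Y i ω ^ 4 ≤ 1 := fun i => by
    have h1 : ∀ᵐ k ∂(binomial (n i) (π i)), k ≤ n i :=
      ae_le_of_hasLaw_binomial (X := id) HasLaw.id
    have h2 : ∀ᵐ y ∂((binomial (n i) (π i)).map fun k : ℕ => (k : ℝ) / (n i : ℝ)), y ^ 4 ≤ 1 := by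
      rw [ae_map_iff (by fun_prop) (measurableSet_le (by fun_prop) (by fun_prop))]
      filter_upwards [h1] with k hk
      exact pow_le_one₀ (by positivity) ((div_le_one (hn0 i)).2 (by exact_mod_cast hk))
    rw [← (hY i).map_eq] at h2
    exact ae_of_ae_map (hY i).aemeasurable h2
  refine regularity_of_fourth_moment_le (q := fun _ => 1) hn0 (fun i => (hY i).aemeasurable)
    hint (fun i => ?_) (fun i => ?_) ⟨fun i => ?_, ⟨4, ?_⟩, ⟨1, ?_⟩⟩ ?_ (fun _ => le_rfl)
    (fun i => ?_)
  · have h := hpow i 1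
    simp only [pow_one] at h
    rw [h, (hm i).1]
    have := hn0 i
    simp
    field_simp
  · rw [hpow, (hm i).2.1]
    have := hn0 i
    obtain ⟨m, hm⟩ : ∃ m, n i = m + 1 := ⟨n i - 1, by have := hn i; omega⟩
    rw [hm] at this ⊢
    simp [Nat.descFactorial_succ] at this ⊢
    field_simp
    ring
  · linarith [hn2 i]
  · rintro _ ⟨i, rfl⟩
    have h1 : (0 : ℝ) < n i + -1 := by linarith [hn2 i]
    have h2 : (n i : ℝ) / (n i + -1) ≤ 2 := by
      rw [div_le_iff₀ h1]
      linarith [hn2 i]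
    have h3 : 0 ≤ (n i : ℝ) / (n i + -1) := div_nonneg (hn0 i).le h1.le
    simp only
    nlinarith
  · rintro _ ⟨i, rfl⟩
    have h1 : (0 : ℝ) < n i + -1 := by linarith [hn2 i]
    refine pow_le_one₀ (by positivity) ((div_le_one h1).2 (by linarith [hn2 i]))
  · simpa using isBigO_refl (fun p : ℕ => (p : ℝ)) atTop
  · simpa using integral_mono_ae (hint i) (integrable_const (1 : ℝ)) (hle i)

/-- The terms `θ i ^ 4` of `E (Y i ^ 4)` and of `E (Y i ^ 2) ^ 2` cancel in `Var (Y i ^ 2)`, so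
bounded averages of `θ i ^ 3` suffice there; in the maximum `θ i ^ 4 = (θ i ^ 3) ^ (4 / 3)` is
admissible. -/
theorem regularity_poisson {τ θ : ℕ → ℝ}
    (hY : ∀ i, HasLaw (Y i)
      ((poissonMeasure (τ i * θ i).toNNReal).map fun k : ℕ => (k : ℝ) / τ i) P)
    (hτ : 0 < ⨅ i, τ i) (hτθ : 0 < ⨅ i, τ i * θ i)
    (hθ : (fun p : ℕ => ∑ i ∈ Finset.range p, θ i ^ 3) =O[atTop] (fun p : ℕ => (p : ℝ))) :
    HasQuadraticVariance 0 1 0 τ θ Y P ∧ RegularityConditions 1 0 τ θ Y P := by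
  obtain ⟨c, hc, hcτ⟩ := exists_pos_le_of_iInf_pos hτ
  obtain ⟨d, hd, hdτ⟩ := exists_pos_le_of_iInf_pos hτθ
  have hτ0 : ∀ i, 0 < τ i := fun i => hc.trans_le (hcτ i)
  have hr0 : ∀ i, 0 < τ i * θ i := fun i => hd.trans_le (hdτ i)
  have hθ0 : ∀ i, 0 < θ i := fun i => pos_of_mul_pos_right (hr0 i) (hτ0 i).le
  have hg : Measurable fun k : ℕ => (k : ℝ) := by fun_prop
  have hm := fun i => moments_of_factorialMoments
    (hasSum_poisson_descFactorial (τ i * θ i).toNNReal)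
  simp only [Real.coe_toNNReal _ (hr0 _).le] at hm
  have hpow := fun i k => (hY i).integral_pow_of_map_div hg k
  obtain ⟨M, hM0, hM⟩ : ∃ M : ℝ, 0 < M ∧ ∀ i, (τ i)⁻¹ ≤ M :=
    ⟨c⁻¹, by positivity, fun i => inv_anti₀ hc (hcτ i)⟩
  have h2 : ∀ i, ∫ ω, Y i ω ^ 2 ∂P = θ i ^ 2 + (τ i)⁻¹ * θ i := fun i => by
    rw [hpow, (hm i).2.1]
    have := hτ0 i
    field_simp
  have h4 : ∀ i, ∫ ω, Y i ω ^ 4 ∂P =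
      θ i ^ 4 + 6 * (τ i)⁻¹ * θ i ^ 3 + 7 * (τ i)⁻¹ ^ 2 * θ i ^ 2 + (τ i)⁻¹ ^ 3 * θ i :=
    fun i => by
    rw [hpow, (hm i).2.2.2]
    have := hτ0 i
    field_simp
  set C : ℝ := 1 + 6 * M + 7 * M ^ 2 + M ^ 3 with hC
  have hC1 : 1 ≤ C := by rw [hC]; nlinarith [pow_pos hM0 2, pow_pos hM0 3]
  have ht1 : ∀ i, θ i ≤ 1 + θ i ^ 3 := fun i => by
    simpa using pow_le_one_add_pow (k := 1) (m := 3) (hθ0 i).le (by norm_num)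
  have ht2 : ∀ i, θ i ^ 2 ≤ 1 + θ i ^ 3 := fun i =>
    pow_le_one_add_pow (hθ0 i).le (by norm_num)
  have ht3 : ∀ i, θ i ^ 3 ≤ 1 + θ i ^ 3 := fun i => by linarith
  have hs2 : ∀ i, (τ i)⁻¹ ^ 2 ≤ M ^ 2 := fun i =>
    pow_le_pow_left₀ (inv_nonneg.2 (hτ0 i).le) (hM i) 2
  have hs3 : ∀ i, (τ i)⁻¹ ^ 3 ≤ M ^ 3 := fun i =>
    pow_le_pow_left₀ (inv_nonneg.2 (hτ0 i).le) (hM i) 3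
  have hCM : M ≤ C := by rw [hC]; nlinarith [pow_pos hM0 2, pow_pos hM0 3]
  refine regularity_of_moments (q := fun i => C * (1 + θ i ^ 3)) hτ0 (fun i => (hY i).aemeasurable)
    (fun i => (hY i).integrable_pow_of_map_div hg (hm i).2.2.1) (fun i => ?_) (fun i => ?_)
    (condD_of_le hc hcτ le_rfl) (isBigO_sum_const_mul_one_add C hθ) (fun i => ?_) (fun i => ?_)
    (fun i => ?_) (fun i => ?_)
  · have h := hpow i 1
    simp only [pow_one] at h
    rw [h, (hm i).1]
    have := hτ0 i
    field_simp
  · rw [h2]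
    ring
  all_goals
    have hθi := hθ0 i
    have hτi := hτ0 i
  · calc (0 + 1 * θ i + 0 * θ i ^ 2) / τ i = (τ i)⁻¹ * θ i := by ring
      _ ≤ C * (1 + θ i ^ 3) := by gcongr; exacts [(hM i).trans hCM, ht1 i]
  · calc (0 + 1 * θ i + 0 * θ i ^ 2) / τ i * θ i ^ 2 = (τ i)⁻¹ * θ i ^ 3 := by ring
      _ ≤ C * (1 + θ i ^ 3) := by gcongr; exacts [(hM i).trans hCM, ht3 i]
  · rw [h4, h2]
    calc _ = 4 * (τ i)⁻¹ * θ i ^ 3 + 6 * (τ i)⁻¹ ^ 2 * θ i ^ 2 + (τ i)⁻¹ ^ 3 * θ i := by ring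
      _ ≤ 4 * M * (1 + θ i ^ 3) + 6 * M ^ 2 * (1 + θ i ^ 3) + M ^ 3 * (1 + θ i ^ 3) := by
        gcongr; exacts [hM i, ht3 i, hM i, ht2 i, hM i, ht1 i]
      _ = (4 * M + 6 * M ^ 2 + M ^ 3) * (1 + θ i ^ 3) := by ring
      _ ≤ C * (1 + θ i ^ 3) := by
        rw [hC]
        gcongr ?_ * _
        nlinarith [pow_pos hM0 2]
  · have hx : θ i ^ 4 = (θ i ^ 3) ^ (4 / 3 : ℝ) := by
      rw [← Real.rpow_natCast_mul hθi.le]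
      norm_num
    have hu1 : ∀ k ≤ 4, θ i ^ k ≤ 1 + θ i ^ 4 := fun k => pow_le_one_add_pow hθi.le
    rw [h4]
    calc _ ≤ (1 + θ i ^ 4) + 6 * M * (1 + θ i ^ 4) + 7 * M ^ 2 * (1 + θ i ^ 4) +
            M ^ 3 * (1 + θ i ^ 4) := by
          gcongr
          exacts [hu1 4 le_rfl, hM i, hu1 3 (by norm_num), hM i, hu1 2 (by norm_num), hM i,
            by simpa using hu1 1 (by norm_num)]
      _ = C * (1 ^ (4 / 3 : ℝ) + (θ i ^ 3) ^ (4 / 3 : ℝ)) := by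
          rw [← hx, Real.one_rpow, hC]; ring
      _ ≤ C ^ (4 / 3 : ℝ) * (1 + θ i ^ 3) ^ (4 / 3 : ℝ) := by
          gcongr
          · exact Real.self_le_rpow_of_one_le hC1 (by norm_num)
          · exact Real.add_rpow_le_rpow_add zero_le_one (by positivity) (by norm_num)
      _ = (C * (1 + θ i ^ 3)) ^ (4 / 3 : ℝ) := by
          rw [Real.mul_rpow (by positivity) (by positivity)]

theorem regularity_negBinomial {n π : ℕ → ℝ} (hπ : ∀ i, π i ∈ Set.Ioo (0 : ℝ) 1)
    (hY : ∀ i, HasLaw (Y i) ((negBinomialMeasure (n i) (π i)).map fun k : ℕ => (k : ℝ) / n i) P)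
    (hnπ : 0 < ⨅ i, n i * π i)
    (hθ : (fun p : ℕ => ∑ i ∈ Finset.range p, (π i / (1 - π i)) ^ 4) =O[atTop]
      (fun p : ℕ => (p : ℝ))) :
    HasQuadraticVariance 0 1 1 n (fun i => π i / (1 - π i)) Y P ∧
      RegularityConditions 1 1 n (fun i => π i / (1 - π i)) Y P := by
  obtain ⟨c, hc, hcn⟩ := exists_pos_le_of_iInf_pos hnπ
  have hn0 : ∀ i, 0 < n i := fun i => pos_of_mul_pos_left (hc.trans_le (hcn i)) (hπ i).1.le
  -- since `π i < 1`, the lower bound on `n i * π i` is also one on `n i`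
  have hcn' : ∀ i, c ≤ n i := fun i =>
    (hcn i).trans (mul_le_of_le_one_right (hn0 i).le (hπ i).2.le)
  set θ : ℕ → ℝ := fun i => π i / (1 - π i) with hθdef
  have hθ0 : ∀ i, 0 < θ i := fun i => div_pos (hπ i).1 (sub_pos.2 (hπ i).2)
  have hg : Measurable fun k : ℕ => (k : ℝ) := by fun_prop
  have hprob := fun i => (hY i).isProbabilityMeasure_of_map_div hg
  have hm := fun i => moments_of_factorialMoments (μ := negBinomialMeasure (n i) (π i))
    (m := fun j => (ascPochhammer ℝ j).eval (n i) * θ i ^ j) (fun j => by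
      simp_rw [negBinomialMeasure_real_singleton (hn0 i) (hπ i)]
      exact hasSum_negBinomial_descFactorial (hπ i) j)
  have hpow := fun i k => (hY i).integral_pow_of_map_div hg k
  obtain ⟨M, hM0, hM⟩ : ∃ M : ℝ, 0 < M ∧ ∀ i, (n i)⁻¹ ≤ M :=
    ⟨c⁻¹, by positivity, fun i => inv_anti₀ hc (hcn' i)⟩
  set C : ℝ := (1 + M) * (1 + 2 * M) * (1 + 3 * M) + 6 * M * (1 + M) * (1 + 2 * M) +
    7 * M ^ 2 * (1 + M) + M ^ 3 with hC
  have hC1 : 1 ≤ C := by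
    have h : C - 1 = 12 * M + 36 * M ^ 2 + 26 * M ^ 3 := by rw [hC]; ring
    have : 0 ≤ 12 * M + 36 * M ^ 2 + 26 * M ^ 3 := by positivity
    linarith
  refine regularity_of_fourth_moment_le (q := fun i => C * (1 + θ i ^ 4)) hn0
    (fun i => (hY i).aemeasurable)
    (fun i => (hY i).integrable_pow_of_map_div hg (hm i).2.2.1) (fun i => ?_) (fun i => ?_)
    (condD_of_le hc hcn' zero_le_one) (isBigO_sum_const_mul_one_add C hθ) (fun i => ?_)
    (fun i => ?_)
  all_goals
    have hθi := hθ0 i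
    have hni := hn0 i
  · have h := hpow i 1
    simp only [pow_one] at h
    rw [h, (hm i).1]
    simp
    field_simp
  · rw [hpow, (hm i).2.1]
    simp [ascPochhammer_succ_right]
    field_simp
    ring
  · nlinarith [pow_pos hθi 4]
  · have hu1 : ∀ k ≤ 4, θ i ^ k ≤ 1 + θ i ^ 4 := fun k => pow_le_one_add_pow hθi.le
    rw [hpow, (hm i).2.2.2]
    calc _ = (1 + (n i)⁻¹) * (1 + 2 * (n i)⁻¹) * (1 + 3 * (n i)⁻¹) * θ i ^ 4 +
          6 * (n i)⁻¹ * (1 + (n i)⁻¹) * (1 + 2 * (n i)⁻¹) * θ i ^ 3 +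
          7 * (n i)⁻¹ ^ 2 * (1 + (n i)⁻¹) * θ i ^ 2 + (n i)⁻¹ ^ 3 * θ i ^ 1 := by
          simp [ascPochhammer_succ_right]
          field_simp
      _ ≤ (1 + M) * (1 + 2 * M) * (1 + 3 * M) * (1 + θ i ^ 4) +
          6 * M * (1 + M) * (1 + 2 * M) * (1 + θ i ^ 4) +
          7 * M ^ 2 * (1 + M) * (1 + θ i ^ 4) + M ^ 3 * (1 + θ i ^ 4) := by
          gcongr ?_ * ?_ + ?_ * ?_ + ?_ * ?_ + ?_ * ?_
          · gcongr <;> exact hM i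
          · exact hu1 4 le_rfl
          · gcongr <;> exact hM i
          · exact hu1 3 (by norm_num)
          · gcongr <;> exact hM i
          · exact hu1 2 (by norm_num)
          · gcongr; exact hM i
          · exact hu1 1 (by norm_num)
      _ = C * (1 + θ i ^ 4) := by rw [hC]; ring

theorem regularity_gamma {α : ℝ} (hα : 0 < α) {τ l : ℕ → ℝ} (hl : ∀ i, 0 < l i)
    (hY : ∀ i, HasLaw (Y i) ((gammaMeasure (τ i * α) (1 / l i)).map fun x : ℝ => x / τ i) P)
    (hτ : 0 < ⨅ i, τ i)
    (hl4 : (fun p : ℕ => ∑ i ∈ Finset.range p, l i ^ 4) =O[atTop] (fun p : ℕ => (p : ℝ))) :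
    HasQuadraticVariance 0 0 (1 / α) τ (fun i => α * l i) Y P ∧
      RegularityConditions 0 (1 / α) τ (fun i => α * l i) Y P := by
  obtain ⟨c, hc, hcτ⟩ := exists_pos_le_of_iInf_pos hτ
  have hτ0 : ∀ i, 0 < τ i := fun i => hc.trans_le (hcτ i)
  have hg : Measurable fun x : ℝ => x := measurable_id
  have hpow : ∀ i k, ∫ ω, Y i ω ^ k ∂P =
      (ascPochhammer ℝ k).eval (τ i * α) / (1 / l i) ^ k / τ i ^ k := fun i k => by
    rw [(hY i).integral_pow_of_map_div hg k,
      integral_pow_gammaMeasure (mul_pos (hτ0 i) hα) (one_div_pos.2 (hl i))]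
  obtain ⟨M, hM0, hM⟩ : ∃ M : ℝ, 0 < M ∧ ∀ i, (τ i)⁻¹ ≤ M :=
    ⟨c⁻¹, by positivity, fun i => inv_anti₀ hc (hcτ i)⟩
  set C : ℝ := 1 + α * (α + M) * (α + 2 * M) * (α + 3 * M) with hC
  have hC1 : 1 ≤ C := by
    have : 0 ≤ α * (α + M) * (α + 2 * M) * (α + 3 * M) := by positivity
    linarith
  refine regularity_of_fourth_moment_le (q := fun i => C * (1 + l i ^ 4)) hτ0
    (fun i => (hY i).aemeasurable)
    (fun i => (hY i).integrable_pow_of_map_div hg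
      (integrable_pow_gammaMeasure (mul_pos (hτ0 i) hα) (one_div_pos.2 (hl i)) 4))
    (fun i => ?_) (fun i => ?_) (condD_of_le hc hcτ (by positivity))
    (isBigO_sum_const_mul_one_add C hl4) (fun i => ?_) (fun i => ?_)
  all_goals
    have hli := hl i
    have hτi := hτ0 i
  · have h := hpow i 1
    simp only [pow_one] at h
    rw [h]
    simp
    field_simp
  · rw [hpow]
    simp [ascPochhammer_succ_right]
    field_simp
  · nlinarith [pow_pos hli 4]
  · rw [hpow]
    calc _ = α * (α + (τ i)⁻¹) * (α + 2 * (τ i)⁻¹) * (α + 3 * (τ i)⁻¹) * l i ^ 4 := by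
          simp [ascPochhammer_succ_right]
          field_simp
      _ ≤ α * (α + M) * (α + 2 * M) * (α + 3 * M) * (1 + l i ^ 4) := by
          gcongr ?_ * ?_
          · gcongr <;> exact hM i
          · linarith
      _ ≤ C * (1 + l i ^ 4) := by
          gcongr
          linarith

/-- The constant `2` in the bound comes from `(1 + l ^ 2) ^ 2 ≤ 2 * (1 + l ^ 4)`. -/
theorem regularity_ghs {α : ℝ} (hα : 0 < α) {τ l : ℕ → ℝ}
    (hY : ∀ i, HasLaw (Y i) ((ghsMeasure (τ i * α) (l i)).map fun x : ℝ => x / τ i) P)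
    (hτ : 0 < ⨅ i, τ i)
    (hl4 : (fun p : ℕ => ∑ i ∈ Finset.range p, l i ^ 4) =O[atTop] (fun p : ℕ => (p : ℝ))) :
    HasQuadraticVariance α 0 (1 / α) τ (fun i => α * l i) Y P ∧
      RegularityConditions 0 (1 / α) τ (fun i => α * l i) Y P := by
  obtain ⟨c, hc, hcτ⟩ := exists_pos_le_of_iInf_pos hτ
  have hτ0 : ∀ i, 0 < τ i := fun i => hc.trans_le (hcτ i)
  have hr0 : ∀ i, 0 < τ i * α := fun i => mul_pos (hτ0 i) hα
  have hg : Measurable fun x : ℝ => x := measurable_id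
  have hpow := fun i k => (hY i).integral_pow_of_map_div hg k
  obtain ⟨M, hM0, hM⟩ : ∃ M : ℝ, 0 < M ∧ ∀ i, (τ i)⁻¹ ≤ M :=
    ⟨c⁻¹, by positivity, fun i => inv_anti₀ hc (hcτ i)⟩
  set C : ℝ := 1 + α * (α + M) * (α + 2 * M) * (α + 3 * M) * 2 with hC
  have hC1 : 1 ≤ C := by
    have : 0 ≤ α * (α + M) * (α + 2 * M) * (α + 3 * M) * 2 := by positivity
    linarith
  refine regularity_of_fourth_moment_le (q := fun i => C * (1 + l i ^ 4)) hτ0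
    (fun i => (hY i).aemeasurable)
    (fun i => (hY i).integrable_pow_of_map_div hg (integrable_pow_four_ghsMeasure (hr0 i) (l i)))
    (fun i => ?_) (fun i => ?_) (condD_of_le hc hcτ (by positivity))
    (isBigO_sum_const_mul_one_add C hl4) (fun i => ?_) (fun i => ?_)
  all_goals
    have hτi := hτ0 i
  · have h := hpow i 1
    simp only [pow_one] at h
    rw [h, integral_id_ghsMeasure (hr0 i)]
    field_simp
  · rw [hpow, integral_sq_ghsMeasure (hr0 i)]
    field_simp
    ring
  · nlinarith [sq_nonneg (l i ^ 2)]
  · rw [hpow]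
    calc _ ≤ τ i * α * (τ i * α + 1) * (τ i * α + 2) * (τ i * α + 3) * (1 + l i ^ 2) ^ 2 /
          τ i ^ 4 := by
          gcongr
          exact integral_pow_four_ghsMeasure_le (hr0 i) (l i)
      _ = α * (α + (τ i)⁻¹) * (α + 2 * (τ i)⁻¹) * (α + 3 * (τ i)⁻¹) * (1 + l i ^ 2) ^ 2 := by
          field_simp
      _ ≤ α * (α + M) * (α + 2 * M) * (α + 3 * M) * (2 * (1 + l i ^ 4)) := by
          gcongr ?_ * ?_
          · gcongr <;> exact hM i
          · nlinarith [sq_nonneg (l i ^ 2 - 1)]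
      _ ≤ C * (1 + l i ^ 4) := by
          rw [hC]
          nlinarith [sq_nonneg (l i ^ 2)]

end Families

theorem mainTheorem6 {Ω : Type*} [MeasurableSpace Ω] (P : Measure Ω) [IsProbabilityMeasure P]
    (Y : ℕ → Ω → ℝ) (hY : iIndepFun Y P) :
    -- binomial
    (∀ (n : ℕ → ℕ) (π : ℕ → unitInterval),
      (∀ i, HasLaw (Y i) ((binomial (n i) (π i)).map fun k : ℕ => (k : ℝ) / (n i : ℝ)) P) →
      (∀ i, 2 ≤ n i) →
      HasQuadraticVariance 0 1 (-1) (fun i => (n i : ℝ)) (fun i => (π i : ℝ)) Y P ∧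
      RegularityConditions 1 (-1) (fun i => (n i : ℝ)) (fun i => (π i : ℝ)) Y P) ∧
    -- Poisson
    (∀ τ θ : ℕ → ℝ,
      (∀ i, HasLaw (Y i)
        ((poissonMeasure (τ i * θ i).toNNReal).map fun k : ℕ => (k : ℝ) / τ i) P) →
      0 < ⨅ i, τ i →
      0 < ⨅ i, τ i * θ i →
      (fun p : ℕ => ∑ i ∈ Finset.range p, θ i ^ 3) =O[atTop] (fun p : ℕ => (p : ℝ)) →
      HasQuadraticVariance 0 1 0 τ θ Y P ∧ RegularityConditions 1 0 τ θ Y P) ∧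
    -- negative binomial
    (∀ n π : ℕ → ℝ,
      (∀ i, π i ∈ Set.Ioo (0 : ℝ) 1) →
      (∀ i, HasLaw (Y i)
        ((negBinomialMeasure (n i) (π i)).map fun k : ℕ => (k : ℝ) / n i) P) →
      0 < ⨅ i, n i * π i →
      (fun p : ℕ => ∑ i ∈ Finset.range p, (π i / (1 - π i)) ^ 4) =O[atTop]
        (fun p : ℕ => (p : ℝ)) →
      HasQuadraticVariance 0 1 1 n (fun i => π i / (1 - π i)) Y P ∧
      RegularityConditions 1 1 n (fun i => π i / (1 - π i)) Y P) ∧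
    -- gamma, with shape `τ i * α` and scale `l i`
    (∀ α : ℝ, 0 < α → ∀ τ l : ℕ → ℝ,
      (∀ i, 0 < l i) →
      (∀ i, HasLaw (Y i) ((gammaMeasure (τ i * α) (1 / l i)).map fun x : ℝ => x / τ i) P) →
      0 < ⨅ i, τ i →
      (fun p : ℕ => ∑ i ∈ Finset.range p, l i ^ 4) =O[atTop] (fun p : ℕ => (p : ℝ)) →
      HasQuadraticVariance 0 0 (1 / α) τ (fun i => α * l i) Y P ∧
      RegularityConditions 0 (1 / α) τ (fun i => α * l i) Y P) ∧
    -- generalized hyperbolic secant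
    (∀ α : ℝ, 0 < α → ∀ τ l : ℕ → ℝ,
      (∀ i, HasLaw (Y i) ((ghsMeasure (τ i * α) (l i)).map fun x : ℝ => x / τ i) P) →
      0 < ⨅ i, τ i →
      (fun p : ℕ => ∑ i ∈ Finset.range p, l i ^ 4) =O[atTop] (fun p : ℕ => (p : ℝ)) →
      HasQuadraticVariance α 0 (1 / α) τ (fun i => α * l i) Y P ∧
      RegularityConditions 0 (1 / α) τ (fun i => α * l i) Y P) :=
  ⟨fun _ _ h hn => regularity_binomial h hn,
    fun _ _ h hτ hτθ hθ => regularity_poisson h hτ hτθ hθ,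
    fun _ _ hπ h hnπ hθ => regularity_negBinomial hπ h hnπ hθ,
    fun _ hα _ _ hl h hτ hl4 => regularity_gamma hα hl h hτ hl4,
    fun _ hα _ _ h hτ hl4 => regularity_ghs hα h hτ hl4⟩
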